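/- Let $1\le k\le n-1$, $\mu>k$, and let $f$ be a continuous (real- or complex-valued) function on $\mathbb R^n$ with $f(x)=O(|x|^{-\mu})$ as $|x|\to\infty$. For a $k$-dimensional affine plane $\tau\subset\mathbb R^n$ let $$\varphi(\tau)=(Rf)(\tau)=\int_\tau f$$ be its $k$-plane transform ($\tau$ carries its Euclidean volume). For $x\in\mathbb R^n$, $r>0$ let $$(R_x^*\varphi)(r)=\int_{SO(n)}\varphi(\gamma\mathbb R^k+x+r\gamma e_n)\,d\gamma,\qquad \mathbb R^k=\mathbb R e_1\oplus\dots\oplus\mathbb R e_k,$$ where $d\gamma$ is the Haar measure of total mass $1$ and $e_1,\dots,e_n$ are the coordinate unit vectors. For $\alpha>0$ and $t>0$ let $$(I^\alpha_{-,2}F)(t)=\frac{2}{\Gamma(\alpha)}\int_t^\infty (s^2-t^2)^{\alpha-1}F(s)\,s\,ds .$$ Call $G$ the Erdélyi–Kober derivative $\mathcal D^{\alpha}_{-,2}F$ of $F$ on $(0,\infty)$ if $G$ is continuous on $(0,\infty)$, $\int_1^\infty |G(s)|s^{2\alpha-1}ds<\infty$, and $F(t)=(I^\alpha_{-,2}G)(t)$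 for all $t>0$. Put $D=\frac1{2t}\frac d{dt}$ and $m=[k/2]$; powers of $t$ stand for multiplication operators. Then the integrals defining $Rf$ and $R_x^*\varphi$ converge absolutely, for every $k$-plane and for all $x\in\mathbb R^n$, $r>0$. For every $x$ the derivative $\mathcal D^{k/2}_{-,2}R_x^*\varphi$ exists and is unique, and $$f(x)=\lim_{t\to0^+}\pi^{-k/2}\,(\mathcal D^{k/2}_{-,2}R_x^*\varphi)(t)\qquad\text{uniformly in }x\in\mathbb R^n .$$ Moreover, for all $x\in\mathbb R^n$ and $t>0$, with $F=R_x^*\varphi$, the value $(\mathcal D^{k/2}_{-,2}F)(t)$ is given by each of the following expressions, in which all integrals converge absolutely and all derivatives exist on $(0,\infty)$ in the classical sense: (i) if $k$ is even: $\;(-D)^{k/2}F$; (ii) for every $1\le k\le n-1$: $\;t^{2-k+2m}(-D)^{m+1}t^{k}\psi$, where $\psi=I^{1-k/2+m}_{-,2}\,t^{-2m-2}F$; and, alternatively, $\;2^{-k}\left(-\frac{d}{dt}\right)^k t\,I^{k/2}_{-,2}\,t^{-k-1}F$; (iii) if $\mu>2+2[k/2]$: $\;(-D)^{m+1}I^{1-k/2+m}_{-,2}F$.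 -/

import Mathlib

open MeasureTheory Set Filter Topology Asymptotics

noncomputable section

namespace KPlaneInversion

/-! ### Fractional integration and differentiation on the half-line -/

section Fractional

variable {V : Type*} [NormedAddCommGroup V] [NormedSpace ℝ V]

/-- The integrand of the modified Erdélyi–Kober integral `(I^α_{-,2} F)(t)`, without `2 / Γ(α)`. -/
def ekIntegrand (α : ℝ) (F : ℝ → V) (t s : ℝ) : V :=
  ((s ^ 2 - t ^ 2) ^ (α - 1) * s) • F s

/-- `(I^α_{-,2} F)(t) = (2 / Γ(α)) ∫_t^∞ (s² - t²)^(α-1) F(s) s ds`. -/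
def ekIntegral (α : ℝ) (F : ℝ → V) (t : ℝ) : V :=
  (2 / Real.Gamma α) • ∫ s in Ioi t, ekIntegrand α F t s

/-- The integral `(I^α_{-,2} F)(t)` converges absolutely for every `t > 0`. -/
def EKConverges (α : ℝ) (F : ℝ → V) : Prop :=
  ∀ t : ℝ, 0 < t → IntegrableOn (ekIntegrand α F t) (Ioi t)

/-- Multiplication by the power `t ^ a`. -/
def powMul (a : ℝ) (F : ℝ → V) (t : ℝ) : V := t ^ a • F t

/-- The operator `-D`, where `D = (1 / (2t)) d/dt`. -/
def negD (F : ℝ → V) (t : ℝ) : V := -((1 / (2 * t)) • deriv F t)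

/-- The operator `-d/dt`. -/
def negDeriv (F : ℝ → V) (t : ℝ) : V := -deriv F t

/-- The first-order differential operator `T` can be applied `j` times to `F` on `(0, ∞)`:
at every stage the function to be differentiated is differentiable at every `t > 0`. -/
def CanIterate (T : (ℝ → V) → ℝ → V) (j : ℕ) (F : ℝ → V) : Prop :=
  ∀ i < j, DifferentiableOn ℝ (T^[i] F) (Ioi 0)

/-- `G` is the Erdélyi–Kober derivative `D^α_{-,2} F` of `F` on `(0, ∞)`, that is, the preimage of
`F` under `I^α_{-,2}`. The preimage is taken among the continuous functions `G` on `(0, ∞)` with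
`∫_1^∞ |G(s)| s^(2α-1) ds < ∞`, so that `(I^α_{-,2} G)(t)` converges absolutely for all `t > 0`
and pointwise values of `G` make sense. -/
structure IsEKDerivative (α : ℝ) (F G : ℝ → V) : Prop where
  continuousOn : ContinuousOn G (Ioi 0)
  integrableOn : IntegrableOn (fun s : ℝ => s ^ (2 * α - 1) • G s) (Ioi 1)
  eq_integral : ∀ t : ℝ, 0 < t → F t = ekIntegral α G t

/-- `I^{1-k/2+m}_{-,2} t^{-2m-2} F` with `m = [k/2]`. -/
def psi (k : ℕ) (F : ℝ → V) : ℝ → V :=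
  ekIntegral (1 - (k : ℝ) / 2 + ((k / 2 : ℕ) : ℝ)) (powMul (-2 * ((k / 2 : ℕ) : ℝ) - 2) F)

/-- `t^{2-k+2m} (-D)^{m+1} t^k ψ`, with `m = [k/2]` and `ψ = I^{1-k/2+m}_{-,2} t^{-2m-2} F`. -/
def complementedForm (k : ℕ) (F : ℝ → V) : ℝ → V :=
  powMul (2 - (k : ℝ) + 2 * ((k / 2 : ℕ) : ℝ)) (negD^[k / 2 + 1] (powMul (k : ℝ) (psi k F)))

/-- `2^{-k} (-d/dt)^k t I^{k/2}_{-,2} t^{-k-1} F`. -/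
def ordinaryForm (k : ℕ) (F : ℝ → V) (t : ℝ) : V :=
  ((2 : ℝ) ^ k)⁻¹ •
    (negDeriv^[k] (powMul 1 (ekIntegral ((k : ℝ) / 2) (powMul (-(k : ℝ) - 1) F)))) t

/-- `(-D)^{m+1} I^{1-k/2+m}_{-,2} F` with `m = [k/2]`. -/
def standardForm (k : ℕ) (F : ℝ → V) : ℝ → V :=
  negD^[k / 2 + 1] (ekIntegral (1 - (k : ℝ) / 2 + ((k / 2 : ℕ) : ℝ)) F)

end Fractional

/-! ### The rotation group `SO(n)` and its normalized Haar measure -/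

/-- The rotation group `SO(n)`. -/
abbrev SO (n : ℕ) : Type := ↥(Matrix.specialOrthogonalGroup (Fin n) ℝ)

theorem SO.coe_inv {n : ℕ} (γ : SO n) :
    ((γ⁻¹ : SO n) : Matrix (Fin n) (Fin n) ℝ) = star (γ : Matrix (Fin n) (Fin n) ℝ) := rfl

instance SO.instIsTopologicalGroup (n : ℕ) : IsTopologicalGroup (SO n) where
  continuous_inv := by
    rw [continuous_induced_rng]
    exact (continuous_star.comp continuous_subtype_val)

instance SO.instCompactSpace (n : ℕ) : CompactSpace (SO n) := by
  have hK : IsCompact (Set.pi univ fun _ : Fin n => Set.pi univ fun _ : Fin n =>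
      Metric.closedBall (0 : ℝ) 1) :=
    isCompact_univ_pi fun _ => isCompact_univ_pi fun _ => isCompact_closedBall 0 1
  have hclosed : IsClosed
      {A : Matrix (Fin n) (Fin n) ℝ | A ∈ Matrix.specialOrthogonalGroup (Fin n) ℝ} := by
    have h : {A : Matrix (Fin n) (Fin n) ℝ | A ∈ Matrix.specialOrthogonalGroup (Fin n) ℝ} =
        {A | A * star A = 1} ∩ {A | A.det = 1} := by
      ext A
      exact Matrix.mem_specialOrthogonalGroup_iff.trans
        (and_congr_left fun _ => Matrix.mem_orthogonalGroup_iff _ _)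
    rw [h]
    exact (isClosed_eq (continuous_id.mul continuous_star) continuous_const).inter
      (isClosed_eq continuous_id.matrix_det continuous_const)
  refine isCompact_iff_compactSpace.1 (hK.of_isClosed_subset hclosed ?_)
  intro A hA i _ j _
  rw [mem_closedBall_zero_iff]
  exact entry_norm_bound_of_unitary (Matrix.mem_specialOrthogonalGroup_iff.1 hA).1 i j

instance SO.instMeasurableSpace (n : ℕ) : MeasurableSpace (SO n) := borel _

instance SO.instBorelSpace (n : ℕ) : BorelSpace (SO n) := ⟨rfl⟩

/-- The Haar measure `dγ` on `SO(n)` of total mass `1`. -/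
def haarSO (n : ℕ) : Measure (SO n) := Measure.haarMeasure ⊤

/-! ### The `k`-plane transform and the shifted dual transform -/

/-- The class `C_μ(ℝⁿ)`: continuous functions with `f(x) = O(|x|^{-μ})` as `|x| → ∞`. -/
def IsCmu {n : ℕ} {V : Type*} [NormedAddCommGroup V] (μ : ℝ)
    (f : EuclideanSpace ℝ (Fin n) → V) : Prop :=
  Continuous f ∧ f =O[cocompact (EuclideanSpace ℝ (Fin n))] fun x => ‖x‖ ^ (-μ)

/-- The `k`-plane transform `(Rf)(τ) = ∫_τ f`, for a `k`-dimensional affine plane `τ`. The measure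
`μHE[k]` is the `k`-dimensional Hausdorff measure normalized to agree with Lebesgue measure on
`k`-dimensional Euclidean spaces, so on `τ` it is the usual volume. -/
def kPlaneTransform {n : ℕ} {V : Type*} [NormedAddCommGroup V] [NormedSpace ℝ V] (k : ℕ)
    (f : EuclideanSpace ℝ (Fin n) → V) (τ : AffineSubspace ℝ (EuclideanSpace ℝ (Fin n))) : V :=
  ∫ y in (τ : Set (EuclideanSpace ℝ (Fin n))), f y ∂μHE[k]

/-- The last coordinate unit vector `e_n` of `ℝⁿ`. -/
def lastVec (n : ℕ) : EuclideanSpace ℝ (Fin n) :=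
  WithLp.toLp 2 fun i => if (i : ℕ) + 1 = n then 1 else 0

/-- The coordinate subspace `ℝ^k = ℝ e_1 ⊕ ⋯ ⊕ ℝ e_k` of `ℝⁿ`. -/
def coordSubspace (n k : ℕ) : Submodule ℝ (EuclideanSpace ℝ (Fin n)) :=
  Submodule.span ℝ ((fun i : Fin n => EuclideanSpace.single i (1 : ℝ)) '' {i | (i : ℕ) < k})

/-- The plane `γ ℝ^k + x + r γ e_n`. -/
def shiftedPlane {n : ℕ} (k : ℕ) (x : EuclideanSpace ℝ (Fin n)) (r : ℝ) (γ : SO n) :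
    AffineSubspace ℝ (EuclideanSpace ℝ (Fin n)) :=
  AffineSubspace.mk' (x + r • Matrix.toEuclideanLin γ.1 (lastVec n))
    ((coordSubspace n k).map (Matrix.toEuclideanLin γ.1))

/-- The shifted dual transform
`(R*_x φ)(r) = ∫_{SO(n)} φ(γ ℝ^k + x + r γ e_n) dγ` of a function `φ` of `k`-planes. -/
def shiftedDual {n : ℕ} {V : Type*} [NormedAddCommGroup V] [NormedSpace ℝ V] (k : ℕ)
    (φ : AffineSubspace ℝ (EuclideanSpace ℝ (Fin n)) → V) (x : EuclideanSpace ℝ (Fin n))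
    (r : ℝ) : V :=
  ∫ γ : SO n, φ (shiftedPlane k x r γ) ∂(haarSO n)

end KPlaneInversion

end

noncomputable section

namespace KPlaneInversion

/-! ### Beta-type integrals -/

section BetaKernels

/-! Averaging over rotations turns the shifted dual of $Rf$ into a one-dimensional integral of
spherical means. A point of the rotated plane is $x+\gamma(y+re_n)$ with $y\in\mathbb R^k$
orthogonal to $e_n$, so it lies at distance $\sqrt{|y|^2+r^2}$ from $x$. After Fubini the integral
over $\gamma$ is the spherical mean $M_xf$ at that radius (`integral_rotation`). Polar coordinates
in $y$ and $s^2=|y|^2+r^2$ then give $R_x^*Rf=\pi^{k/2}I^{k/2}_{-,2}M_xf$ (`integral_radial_shift`,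
`shiftedDual_kPlaneTransform`). Hence $\pi^{k/2}M_xf$ is an Erdélyi–Kober derivative, and
$M_xf(t)\to f(x)$ uniformly because a continuous function vanishing at infinity is uniformly
continuous.

The explicit formulas do not involve $f$: they invert $F=I^{k/2}_{-,2}G$ for any admissible $G$. For
even $k$ this operator is itself an iterated integral in the variable $t^2$. Otherwise a second
fractional integral, with a suitable power weight in between, produces an iterated integral. By
Fubini (`integral_kernel_comp`) only the composed kernels need computing, and they are beta
integrals: with $\alpha+\beta=m+1$, `ekKernel_comp_weighted` gives $t^{2\beta}I^\alpha
t^{-2(\alpha+\beta)}I^\beta=I^{m+1}t^{-2\alpha}$; `ekKernel_comp` gives $I^\alpha I^\beta=I^{m+1}$;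
`ekKernel_comp_ordinary` turns $t\,I^{k/2}t^{-k-1}I^{k/2}$ into a $k$-fold ordinary integral.
Differentiating (`negWDeriv_iterInt`) recovers $G$. In the first identity the factor $t^{-2\alpha}$
compensates for the higher order, so the integrability of $G$ built into the definition is enough;
the second needs more decay. The first formula expresses $G$ through $F$ alone, which also proves
uniqueness. -/

theorem betaIntegrand_eq {α β z : ℝ} (hz : z ∈ Icc (0 : ℝ) 1) :
    (z : ℂ) ^ ((α : ℂ) - 1) * (1 - (z : ℂ)) ^ ((β : ℂ) - 1) =
      ((z ^ (α - 1) * (1 - z) ^ (β - 1) : ℝ) : ℂ) := by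
  rw [Complex.ofReal_mul, Complex.ofReal_cpow hz.1, Complex.ofReal_cpow (sub_nonneg.2 hz.2)]
  push_cast
  rfl

theorem integrableOn_beta {α β : ℝ} (hα : 0 < α) (hβ : 0 < β) :
    IntegrableOn (fun z : ℝ => z ^ (α - 1) * (1 - z) ^ (β - 1)) (Icc 0 1) := by
  have h := Complex.betaIntegral_convergent (u := α) (v := β) (by simpa) (by simpa)
  rw [intervalIntegrable_iff_integrableOn_Icc_of_le zero_le_one] at h
  have h2 := (h.congr_fun (fun z hz => betaIntegrand_eq hz) measurableSet_Icc).re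
  exact h2.congr (ae_of_all _ fun z => Complex.ofReal_re _)

theorem integral_beta {α β : ℝ} (hα : 0 < α) (hβ : 0 < β) :
    ∫ z in Icc (0 : ℝ) 1, z ^ (α - 1) * (1 - z) ^ (β - 1) =
      Real.Gamma α * Real.Gamma β / Real.Gamma (α + β) := by
  have h := ProbabilityTheory.beta_eq_betaIntegralReal α β hα hβ
  rw [ProbabilityTheory.beta] at h
  rw [h, Complex.betaIntegral, intervalIntegral.integral_of_le zero_le_one,
    ← integral_Icc_eq_integral_Ioc,
    setIntegral_congr_fun measurableSet_Icc fun z hz => betaIntegrand_eq hz, integral_complex_ofReal,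
    Complex.ofReal_re]

/-- Substitution in the beta integral. -/
theorem beta_substitution {α β : ℝ} (hα : 0 < α) (hβ : 0 < β) {t s : ℝ} (hts : t < s)
    {z z' g : ℝ → ℝ} {c : ℝ} (hz : ContinuousOn z (Icc t s))
    (hz' : ∀ r ∈ Ioo t s, HasDerivAt z (z' r) r) (hpos : ∀ r ∈ Ioo t s, 0 ≤ z' r)
    (hzt : z t = 0) (hzs : z s = 1)
    (hg : ∀ r ∈ Ioo t s, g r = c * (z' r * (z r ^ (α - 1) * (1 - z r) ^ (β - 1)))) :
    IntegrableOn g (Ioo t s) ∧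
      ∫ r in Ioo t s, g r = c * (Real.Gamma α * Real.Gamma β / Real.Gamma (α + β)) := by
  have h1 := (integrableOn_Icc_deriv_smul_iff_of_deriv_nonneg
    (g := fun z : ℝ => z ^ (α - 1) * (1 - z) ^ (β - 1)) hz hz' hpos hts.le).2
      (by rw [hzt, hzs]; exact integrableOn_beta hα hβ)
  have h2 := integral_Icc_deriv_smul_of_deriv_nonneg
    (g := fun z : ℝ => z ^ (α - 1) * (1 - z) ^ (β - 1)) hz hz' hpos hts.le
  rw [hzt, hzs, integral_beta hα hβ, integral_Icc_eq_integral_Ioo] at h2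
  refine ⟨(IntegrableOn.congr_fun ((h1.mono_set Ioo_subset_Icc_self).const_mul c)
    (fun r hr => (hg r hr).symm) measurableSet_Ioo), ?_⟩
  rw [setIntegral_congr_fun measurableSet_Ioo hg, integral_const_mul]
  simp only [smul_eq_mul] at h2
  rw [h2]

/-- The kernel of the product of two Erdélyi–Kober integrals. -/
theorem ekKernel_comp {α β : ℝ} (hα : 0 < α) (hβ : 0 < β) {t s : ℝ} (ht : 0 < t) (hts : t < s) :
    IntegrableOn (fun r => ((r ^ 2 - t ^ 2) ^ (α - 1) * r) * ((s ^ 2 - r ^ 2) ^ (β - 1) * s))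
      (Ioo t s) ∧
    ∫ r in Ioo t s, ((r ^ 2 - t ^ 2) ^ (α - 1) * r) * ((s ^ 2 - r ^ 2) ^ (β - 1) * s) =
      ((s ^ 2 - t ^ 2) ^ (α + β - 1) * s / 2) *
        (Real.Gamma α * Real.Gamma β / Real.Gamma (α + β)) := by
  have hd : 0 < s ^ 2 - t ^ 2 := by nlinarith
  refine beta_substitution hα hβ hts (z := fun r => (r ^ 2 - t ^ 2) / (s ^ 2 - t ^ 2))
    (z' := fun r => (2 * r) / (s ^ 2 - t ^ 2)) (by fun_prop) ?_ ?_ (by simp) (div_self hd.ne') ?_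
  · intro r _
    refine HasDerivAt.div_const ?_ _
    simpa using (hasDerivAt_pow 2 r).sub_const (t ^ 2)
  · intro r hr
    have : 0 < r := ht.trans hr.1
    positivity
  · intro r hr
    have hr0 : 0 < r := ht.trans hr.1
    have h1 : 0 < r ^ 2 - t ^ 2 := by nlinarith [hr.1]
    have h2 : 0 < s ^ 2 - r ^ 2 := by nlinarith [hr.2]
    have e1 : 1 - (r ^ 2 - t ^ 2) / (s ^ 2 - t ^ 2) = (s ^ 2 - r ^ 2) / (s ^ 2 - t ^ 2) := by
      field_simp; ring
    simp only [e1]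
    rw [Real.div_rpow h1.le hd.le, Real.div_rpow h2.le hd.le,
      show α + β - 1 = (α - 1) + (β - 1) + 1 by ring, Real.rpow_add hd, Real.rpow_add hd,
      Real.rpow_one]
    have := (Real.rpow_pos_of_pos hd (α - 1)).ne'
    have := (Real.rpow_pos_of_pos hd (β - 1)).ne'
    field_simp

/-- The kernel of `I^α t^{-2(α+β)} I^β`. -/
theorem ekKernel_comp_weighted {α β : ℝ} (hα : 0 < α) (hβ : 0 < β) {t s : ℝ} (ht : 0 < t)
    (hts : t < s) :
    IntegrableOn (fun r => ((r ^ 2 - t ^ 2) ^ (α - 1) * r * r ^ (-(2 * (α + β)))) *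
      ((s ^ 2 - r ^ 2) ^ (β - 1) * s)) (Ioo t s) ∧
    ∫ r in Ioo t s, ((r ^ 2 - t ^ 2) ^ (α - 1) * r * r ^ (-(2 * (α + β)))) *
      ((s ^ 2 - r ^ 2) ^ (β - 1) * s) =
      ((s ^ 2 - t ^ 2) ^ (α + β - 1) * s / 2 * (s ^ (-(2 * α)) * t ^ (-(2 * β)))) *
        (Real.Gamma α * Real.Gamma β / Real.Gamma (α + β)) := by
  have hs : 0 < s := ht.trans hts
  have hd : 0 < s ^ 2 - t ^ 2 := by nlinarith
  -- The variable $z$ is affine in $r^{-2}$ and runs from 0 to 1. The powers of $r$ from $z'$,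
  -- $z^{\alpha-1}$ and $(1-z)^{\beta-1}$ combine to $r^{1-2(\alpha+\beta)}$, which is exactly the
  -- weight present in the kernel.
  refine beta_substitution hα hβ hts
    (z := fun r => (s ^ 2 / (s ^ 2 - t ^ 2)) * (1 - t ^ 2 * r ^ (-2 : ℤ)))
    (z' := fun r => (s ^ 2 / (s ^ 2 - t ^ 2)) * (2 * t ^ 2 * r ^ (-3 : ℤ))) ?_ ?_ ?_ ?_ ?_ ?_
  · refine continuousOn_const.mul (continuousOn_const.sub (continuousOn_const.mul ?_))
    exact continuousOn_id.zpow₀ _ fun r hr => Or.inl (ht.trans_le hr.1).ne'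
  · intro r hr
    have hr0 : 0 < r := ht.trans hr.1
    have h := (((hasDerivAt_zpow (-2) r (Or.inl hr0.ne')).const_mul (t ^ 2)).const_sub 1).const_mul
      (s ^ 2 / (s ^ 2 - t ^ 2))
    refine h.congr_deriv ?_
    norm_num
    left; ring
  · intro r hr
    have hr0 : 0 < r := ht.trans hr.1
    positivity
  · simp only [zpow_neg]
    rw [show (2 : ℤ) = ((2 : ℕ) : ℤ) by rfl, zpow_natCast, mul_inv_cancel₀ (by positivity)]
    simp
  · simp only [zpow_neg]
    rw [show (2 : ℤ) = ((2 : ℕ) : ℤ) by rfl, zpow_natCast]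
    field_simp
  · intro r hr
    have hr0 : 0 < r := ht.trans hr.1
    have h1 : 0 < r ^ 2 - t ^ 2 := by nlinarith [hr.1]
    have h2 : 0 < s ^ 2 - r ^ 2 := by nlinarith [hr.2]
    have e0 : s ^ 2 / (s ^ 2 - t ^ 2) * (1 - t ^ 2 * r ^ (-2 : ℤ)) =
        (s ^ 2 * (r ^ 2 - t ^ 2)) / ((s ^ 2 - t ^ 2) * r ^ 2) := by
      rw [zpow_neg, show (2 : ℤ) = ((2 : ℕ) : ℤ) by rfl, zpow_natCast]
      field_simp
    have e1 : 1 - (s ^ 2 * (r ^ 2 - t ^ 2)) / ((s ^ 2 - t ^ 2) * r ^ 2) =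
        (t ^ 2 * (s ^ 2 - r ^ 2)) / ((s ^ 2 - t ^ 2) * r ^ 2) := by
      field_simp; ring
    have e2 : ∀ x : ℝ, 0 < x → ∀ a : ℝ, (x ^ 2) ^ (a - 1) = x ^ (2 * a) / x ^ 2 := by
      intro x hx a
      rw [← Real.rpow_natCast, ← Real.rpow_mul hx.le, ← Real.rpow_sub hx]
      congr 1; push_cast; ring
    simp only [e0, e1]
    rw [Real.div_rpow (by positivity) (by positivity), Real.div_rpow (by positivity) (by positivity),
      Real.mul_rpow (by positivity) (by positivity), Real.mul_rpow (by positivity) (by positivity),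
      Real.mul_rpow (by positivity) (by positivity), Real.mul_rpow (by positivity) (by positivity),
      e2 s hs, e2 t ht, e2 r hr0, e2 r hr0,
      show α + β - 1 = (α - 1) + (β - 1) + 1 by ring, Real.rpow_add hd, Real.rpow_add hd,
      Real.rpow_one, Real.rpow_neg hr0.le, Real.rpow_neg hs.le, Real.rpow_neg ht.le,
      show 2 * (α + β) = 2 * α + 2 * β by ring, Real.rpow_add hr0, zpow_neg,
      show (3 : ℤ) = ((3 : ℕ) : ℤ) by rfl, zpow_natCast]
    have := (Real.rpow_pos_of_pos hd (α - 1)).ne'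
    have := (Real.rpow_pos_of_pos hd (β - 1)).ne'
    have := (Real.rpow_pos_of_pos hs (2 * α)).ne'
    have := (Real.rpow_pos_of_pos ht (2 * β)).ne'
    have := (Real.rpow_pos_of_pos hr0 (2 * α)).ne'
    have := (Real.rpow_pos_of_pos hr0 (2 * β)).ne'
    field_simp

/-- The kernel of `I^a t^{-2a-1} I^a`, which is a power of the difference. -/
theorem ekKernel_comp_ordinary {a : ℝ} (ha : 0 < a) {t s : ℝ} (ht : 0 < t) (hts : t < s) :
    IntegrableOn (fun r => ((r ^ 2 - t ^ 2) ^ (a - 1) * r * r ^ (-(2 * a) - 1)) *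
      ((s ^ 2 - r ^ 2) ^ (a - 1) * s)) (Ioo t s) ∧
    ∫ r in Ioo t s, ((r ^ 2 - t ^ 2) ^ (a - 1) * r * r ^ (-(2 * a) - 1)) *
      ((s ^ 2 - r ^ 2) ^ (a - 1) * s) =
      (s - t) ^ (2 * a - 1) * 4 ^ (a - 1) / t *
        (Real.Gamma a * Real.Gamma a / Real.Gamma (a + a)) := by
  have hs : 0 < s := ht.trans hts
  have hd : 0 < s - t := by linarith
  -- With $u=r-st/r$ one has $(s-t)^2-u^2=(r^2-t^2)(s^2-r^2)/r^2$, and $u$ increases from $-(s-t)$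
  -- to $s-t$. Since $du=(1+st/r^2)\,dr$, the integral of $(1+st/r^2)Q$ is a symmetric beta
  -- integral, while the kernel itself is $sQ/r^2$.
  set Q : ℝ → ℝ := fun r => ((s - t) ^ 2 - (r - s * t / r) ^ 2) ^ (a - 1) with hQ
  have hsub := beta_substitution ha ha hts
    (z := fun r => (1 + (r - s * t * r⁻¹) / (s - t)) / 2)
    (z' := fun r => (1 - s * t * -(r ^ 2)⁻¹) / (s - t) / 2)
    (g := fun r => (1 + s * t / r ^ 2) * Q r) (c := 2 * (s - t) ^ (2 * a - 1) * 4 ^ (a - 1))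
    (by
      have : ContinuousOn (fun r : ℝ => r⁻¹) (Icc t s) :=
        continuousOn_id.inv₀ fun r hr => (ht.trans_le hr.1).ne'
      fun_prop)
    (by
      intro r hr
      have hr0 : 0 < r := ht.trans hr.1
      exact ((((hasDerivAt_id r).sub ((hasDerivAt_inv hr0.ne').const_mul (s * t))).div_const
        (s - t)).const_add 1).div_const 2)
    (by
      intro r hr
      have hr0 : 0 < r := ht.trans hr.1
      have : 0 ≤ 1 - s * t * -(r ^ 2)⁻¹ := by
        have : 0 ≤ s * t * (r ^ 2)⁻¹ := by positivity
        linarith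
      positivity)
    (by field_simp; ring)
    (by field_simp; ring)
    (by
      intro r hr
      have hr0 : 0 < r := ht.trans hr.1
      have e0 : (1 + (r - s * t * r⁻¹) / (s - t)) / 2 = ((r + s) * (r - t)) / (2 * (s - t) * r) := by
        field_simp; ring
      have e1 : 1 - ((r + s) * (r - t)) / (2 * (s - t) * r) =
          ((s - r) * (r + t)) / (2 * (s - t) * r) := by
        field_simp; ring
      have e2 : (s - t) ^ 2 - (r - s * t / r) ^ 2 =
          (4 * (s - t) ^ 2) * ((((r + s) * (r - t)) / (2 * (s - t) * r)) *
            (((s - r) * (r + t)) / (2 * (s - t) * r))) := by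
        field_simp; ring
      have e3 : ((s - t) ^ 2) ^ (a - 1) = (s - t) ^ (2 * a - 1) / (s - t) := by
        rw [← Real.rpow_natCast, ← Real.rpow_mul hd.le, ← Real.rpow_sub_one hd.ne']
        congr 1; push_cast; ring
      have h1 : 0 < r - t := sub_pos.2 hr.1
      have h2 : 0 < s - r := sub_pos.2 hr.2
      simp only [hQ, e0, e1, e2]
      rw [Real.mul_rpow (by positivity) (by positivity), Real.mul_rpow (by positivity)
        (by positivity), Real.mul_rpow (by positivity) (by positivity), e3]
      field_simp
      ring)
  have hQi : IntegrableOn (fun r => Q r / r ^ 2) (Ioo t s) := by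
    refine (hsub.1.bdd_mul (c := 1 / (s * t)) (f := fun r => 1 / (r ^ 2 + s * t))
      (Measurable.aestronglyMeasurable (by fun_prop)) ?_).congr ?_
    · refine ae_of_all _ fun r => ?_
      rw [Real.norm_of_nonneg (by positivity)]
      gcongr
      nlinarith [sq_nonneg r]
    · refine (ae_restrict_mem measurableSet_Ioo).mono fun r hr => ?_
      have hr0 : 0 < r := ht.trans hr.1
      simp only
      field_simp
  have hQ1 : IntegrableOn Q (Ioo t s) := by
    refine (hsub.1.sub (hQi.const_mul (s * t))).congr ?_
    refine (ae_restrict_mem measurableSet_Ioo).mono fun r hr => ?_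
    simp only [Pi.sub_apply]
    ring
  -- The involution $r\mapsto st/r$ of $(t,s)$ changes the sign of $u$, hence preserves $Q$, and
  -- takes $dr$ to $st\,r^{-2}dr$. The two terms of $\int(1+st/r^2)Q$ are therefore equal.
  have hsymm : s * t * ∫ r in Ioo t s, Q r / r ^ 2 = ∫ r in Ioo t s, Q r := by
    have h := integral_Icc_deriv_smul_of_deriv_nonpos (f := fun r => s * t * r⁻¹) (g := Q)
      (f' := fun r => s * t * -(r ^ 2)⁻¹) (a := t) (b := s)
      (continuousOn_const.mul (continuousOn_id.inv₀ fun r hr => (ht.trans_le hr.1).ne'))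
      (fun r hr => (hasDerivAt_inv (ht.trans hr.1).ne').const_mul (s * t))
      (fun r hr => by
        have : 0 ≤ s * t * (r ^ 2)⁻¹ := by positivity
        linarith) hts.le
    have e1 : s * t * s⁻¹ = t := by field_simp
    have e2 : s * t * t⁻¹ = s := by field_simp
    rw [e1, e2, integral_Icc_eq_integral_Ioo, integral_Icc_eq_integral_Ioo] at h
    rw [← neg_inj, ← h, ← neg_mul, ← integral_const_mul]
    refine setIntegral_congr_fun measurableSet_Ioo fun r hr => ?_
    have hr0 : 0 < r := ht.trans hr.1
    have : s * t * r⁻¹ - s * t / (s * t * r⁻¹) = -(r - s * t / r) := by field_simp; ring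
    simp only [hQ, this, neg_sq, smul_eq_mul]
    field_simp
  have hval : 2 * (s * t) * ∫ r in Ioo t s, Q r / r ^ 2 =
      2 * (s - t) ^ (2 * a - 1) * 4 ^ (a - 1) *
        (Real.Gamma a * Real.Gamma a / Real.Gamma (a + a)) := by
    rw [← hsub.2, mul_assoc, two_mul]
    nth_rewrite 1 [hsymm]
    rw [← integral_const_mul, ← integral_add hQ1 (hQi.const_mul _)]
    congr 1 with r
    ring
  have hE : ∀ r ∈ Ioo t s, s * (Q r / r ^ 2) =
      ((r ^ 2 - t ^ 2) ^ (a - 1) * r * r ^ (-(2 * a) - 1)) * ((s ^ 2 - r ^ 2) ^ (a - 1) * s) := by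
    intro r hr
    have hr0 : 0 < r := ht.trans hr.1
    have h1 : 0 < r ^ 2 - t ^ 2 := by nlinarith [hr.1]
    have h2 : 0 < s ^ 2 - r ^ 2 := by nlinarith [hr.2]
    have e2 : (s - t) ^ 2 - (r - s * t / r) ^ 2 = (r ^ 2 - t ^ 2) * (s ^ 2 - r ^ 2) / r ^ 2 := by
      field_simp; ring
    have e3 : (r ^ 2) ^ (a - 1) = r ^ (2 * a) / r ^ 2 := by
      rw [← Real.rpow_natCast, ← Real.rpow_mul hr0.le, ← Real.rpow_sub hr0]
      congr 1; push_cast; ring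
    simp only [hQ, e2]
    rw [Real.div_rpow (by positivity) (by positivity), Real.mul_rpow h1.le h2.le, e3,
      Real.rpow_sub_one hr0.ne', Real.rpow_neg hr0.le]
    have := (Real.rpow_pos_of_pos hr0 (2 * a)).ne'
    field_simp
  refine ⟨IntegrableOn.congr_fun (hQi.const_mul s) hE measurableSet_Ioo, ?_⟩
  rw [← setIntegral_congr_fun measurableSet_Ioo hE, integral_const_mul]
  have h3 : s * ∫ r in Ioo t s, Q r / r ^ 2 =
      (2 * (s * t) * ∫ r in Ioo t s, Q r / r ^ 2) / (2 * t) := by field_simp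
  rw [h3, hval]
  field_simp

end BetaKernels

/-! ### Composition of Volterra-type integrals -/

section Volterra

theorem aestronglyMeasurable_Ioi {V : Type*} [NormedAddCommGroup V] {G : ℝ → V} (hG : ContinuousOn G (Ioi 0)) {t : ℝ} (ht : 0 < t) :
    AEStronglyMeasurable G (volume.restrict (Ioi t)) :=
  (hG.mono (Ioi_subset_Ioi ht.le)).aestronglyMeasurable measurableSet_Ioi

variable {V : Type*} [NormedAddCommGroup V] [NormedSpace ℝ V]

/-- Fubini's theorem for the composition of two integral operators with kernels supported in
`t < r < s`. -/
theorem integral_kernel_comp [CompleteSpace V] {A K : ℝ → ℝ} {B : ℝ → ℝ → ℝ} {G : ℝ → V} {t : ℝ}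
    (hA : Measurable A) (hB : Measurable (Function.uncurry B))
    (hA0 : ∀ r, t < r → 0 ≤ A r) (hB0 : ∀ r s, t < r → r < s → 0 ≤ B r s)
    (hK : ∀ s, t < s → IntegrableOn (fun r => A r * B r s) (Ioo t s) ∧
      ∫ r in Ioo t s, A r * B r s = K s)
    (hG : AEStronglyMeasurable G (volume.restrict (Ioi t)))
    (hKG : IntegrableOn (fun s => K s • G s) (Ioi t)) :
    IntegrableOn (fun r => A r • ∫ s in Ioi r, B r s • G s) (Ioi t) ∧
      ∫ r in Ioi t, A r • ∫ s in Ioi r, B r s • G s = ∫ s in Ioi t, K s • G s := by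
  set ν := (volume : Measure ℝ).restrict (Ioi t) with hν
  set k : ℝ → ℝ → ℝ := fun r s => if r < s then A r * B r s else 0 with hk
  have hkm : Measurable (Function.uncurry k) := by
    refine Measurable.ite (measurableSet_lt measurable_fst measurable_snd) ?_ measurable_const
    exact (hA.comp measurable_fst).mul hB
  have hk0 : ∀ r s, t < r → 0 ≤ k r s := by
    intro r s hr
    simp only [hk]
    split_ifs with h
    · exact mul_nonneg (hA0 r hr) (hB0 r s hr h)
    · exact le_rfl
  have hslice : ∀ s, t < s → Integrable (fun r => k r s) ν ∧ ∫ r, k r s ∂ν = K s := by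
    intro s hs
    have e : (fun r => k r s) = (Iio s).indicator (fun r => A r * B r s) := by
      ext r
      simp [hk, indicator]
    have hset : Iio s ∩ Ioi t = Ioo t s := by ext; simp [and_comm]
    rw [e, integrable_indicator_iff measurableSet_Iio, integral_indicator measurableSet_Iio,
      IntegrableOn, hν, Measure.restrict_restrict measurableSet_Iio, hset]
    exact hK s hs
  -- The kernels are nonnegative, so integrating the norm over $r$ gives exactly $K(s)\|G(s)\|$;
  -- integrability on the product is thus equivalent to the hypothesis on $K\,G$.
  have hprod : Integrable (Function.uncurry fun r s => k r s • G s) (ν.prod ν) := by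
    have hm : AEStronglyMeasurable (Function.uncurry fun r s => k r s • G s) (ν.prod ν) :=
      hkm.aestronglyMeasurable.smul hG.comp_snd
    rw [integrable_prod_iff' hm]
    constructor
    · refine (ae_restrict_mem measurableSet_Ioi).mono fun s hs => ?_
      exact (hslice s hs).1.smul_const (G s)
    · refine hKG.norm.congr ((ae_restrict_mem measurableSet_Ioi).mono fun s hs => ?_)
      have hs' := hslice s hs
      have hKs : 0 ≤ K s := by
        rw [← hs'.2]
        exact integral_nonneg_of_ae ((ae_restrict_mem measurableSet_Ioi).mono fun r hr =>
          hk0 r s hr)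
      simp only [Function.uncurry_apply_pair, norm_smul]
      rw [integral_mul_const]
      congr 1
      rw [Real.norm_of_nonneg hKs, ← hs'.2]
      refine integral_congr_ae ((ae_restrict_mem measurableSet_Ioi).mono fun r hr => ?_)
      exact (Real.norm_of_nonneg (hk0 r s hr)).symm
  have hinner : ∀ r ∈ Ioi t, ∫ s, k r s • G s ∂ν = A r • ∫ s in Ioi r, B r s • G s := by
    intro r hr
    have e : (fun s => k r s • G s) = (Ioi r).indicator (fun s => A r • (B r s • G s)) := by
      ext s
      by_cases h : r < s <;> simp [hk, indicator, h, mul_smul]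
    have hset : Ioi r ∩ Ioi t = Ioi r := inter_eq_left.2 (Ioi_subset_Ioi (le_of_lt hr))
    rw [e, integral_indicator measurableSet_Ioi, hν, Measure.restrict_restrict measurableSet_Ioi,
      hset, integral_smul]
  have houter : ∀ s ∈ Ioi t, ∫ r, k r s • G s ∂ν = K s • G s := by
    intro s hs
    rw [integral_smul_const, (hslice s hs).2]
  refine ⟨hprod.integral_prod_left.congr ((ae_restrict_mem measurableSet_Ioi).mono hinner), ?_⟩
  rw [← setIntegral_congr_fun measurableSet_Ioi hinner, ← setIntegral_congr_fun measurableSet_Ioi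
    houter]
  exact integral_integral_swap hprod

/-- Fundamental theorem of calculus for the tail integral. -/
theorem hasDerivAt_integral_Ioi_tail [CompleteSpace V] {H : ℝ → V} (hH : ContinuousOn H (Ioi 0))
    (hi : ∀ t, 0 < t → IntegrableOn H (Ioi t)) {t : ℝ} (ht : 0 < t) :
    HasDerivAt (fun x => ∫ s in Ioi x, H s) (-H t) t := by
  have h2 : 0 < t / 2 := half_pos ht
  have hint : ∀ x, t / 2 ≤ x → IntervalIntegrable H volume (t / 2) x := by
    intro x hx
    rw [intervalIntegrable_iff_integrableOn_Ioc_of_le hx]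
    exact (hi _ h2).mono_set Ioc_subset_Ioi_self
  have hd : HasDerivAt (fun x => ∫ s in (t / 2)..x, H s) (H t) t :=
    intervalIntegral.integral_hasDerivAt_right (hint t (by linarith))
      (ContinuousOn.stronglyMeasurableAtFilter isOpen_Ioi hH t ht)
      (hH.continuousAt (Ioi_mem_nhds ht))
  have heq : (fun x => ∫ s in Ioi x, H s) =ᶠ[𝓝 t]
      fun x => (∫ s in Ioi (t / 2), H s) - ∫ s in (t / 2)..x, H s := by
    filter_upwards [Ioi_mem_nhds (show t / 2 < t by linarith)] with x hx
    rw [intervalIntegral.integral_of_le (le_of_lt hx), eq_sub_iff_add_eq, add_comm,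
      ← setIntegral_union (Ioc_disjoint_Ioi le_rfl) measurableSet_Ioi
        ((hi _ h2).mono_set Ioc_subset_Ioi_self) (hi x (h2.trans hx)),
      Ioc_union_Ioi_eq_Ioi (le_of_lt hx)]
  exact (hd.const_sub _).congr_of_eventuallyEq heq

/-- A kernel with at most polynomial growth is integrable against a continuous function with the
corresponding weighted integrability at infinity. -/
theorem integrableOn_kernel_smul {G : ℝ → V} (hG : ContinuousOn G (Ioi 0)) {c : ℝ}
    (hi : IntegrableOn (fun s : ℝ => s ^ c • G s) (Ioi 1)) {κ : ℝ → ℝ} (hκ : Measurable κ)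
    {t T C : ℝ} (ht : 0 < t) (htT : t ≤ T) (hT : 1 ≤ T) (hloc : IntegrableOn κ (Icc t T))
    (hfar : ∀ s, T < s → |κ s| ≤ C * s ^ c) :
    IntegrableOn (fun s => κ s • G s) (Ioi t) := by
  rw [← Ioc_union_Ioi_eq_Ioi htT]
  refine IntegrableOn.union ?_ ?_
  · exact (hloc.smul_continuousOn (hG.mono fun s hs => ht.trans_le hs.1) isCompact_Icc).mono_set
      Ioc_subset_Icc_self
  · have h1 : IntegrableOn (fun s : ℝ => s ^ c • G s) (Ioi T) := hi.mono_set (Ioi_subset_Ioi hT)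
    refine Integrable.mono' (h1.norm.const_mul C)
      (hκ.aestronglyMeasurable.smul (aestronglyMeasurable_Ioi hG (by linarith))) ?_
    refine (ae_restrict_mem measurableSet_Ioi).mono fun s hs => ?_
    have hs0 : 0 < s := lt_of_lt_of_le (by linarith) (le_of_lt hs)
    rw [norm_smul, norm_smul, Real.norm_eq_abs, Real.norm_of_nonneg (Real.rpow_nonneg hs0.le c),
      ← mul_assoc]
    exact mul_le_mul_of_nonneg_right (hfar s hs) (norm_nonneg _)

end Volterra

/-! ### Iterated integrals -/

section Iterated

variable {V : Type*} [NormedAddCommGroup V] [NormedSpace ℝ V]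

/-- The `(j + 1)`-fold integral with respect to `p`, where `w = p'`. -/
def iterInt (p w : ℝ → ℝ) (j : ℕ) (G : ℝ → V) (t : ℝ) : V :=
  ((j.factorial : ℝ)⁻¹) • ∫ s in Ioi t, ((p s - p t) ^ j * w s) • G s

/-- The operator `-w⁻¹ d/dt`. -/
def negWDeriv (w : ℝ → ℝ) (F : ℝ → V) (t : ℝ) : V := -((w t)⁻¹ • deriv F t)

/-- The integral identities hold only on $(0,\infty)$; since this set is open, they pass to
derivatives there. -/
theorem iterate_negWDeriv_congr {w : ℝ → ℝ} {F F' : ℝ → V} (h : EqOn F F' (Ioi 0)) (i : ℕ) :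
    EqOn ((negWDeriv w)^[i] F) ((negWDeriv w)^[i] F') (Ioi 0) := by
  induction i generalizing F F' with
  | zero => exact h
  | succ i ih =>
    simp only [Function.iterate_succ_apply]
    refine ih fun t ht => ?_
    simp only [negWDeriv]
    rw [Filter.EventuallyEq.deriv_eq (h.eventuallyEq_of_mem (Ioi_mem_nhds ht))]

theorem CanIterate.congr {w : ℝ → ℝ} {j : ℕ} {F F' : ℝ → V} (hF : CanIterate (negWDeriv w) j F)
    (h : EqOn F F' (Ioi 0)) : CanIterate (negWDeriv w) j F' :=
  fun i hi => (hF i hi).congr (iterate_negWDeriv_congr h i).symm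

theorem negWDeriv_two_mul : negWDeriv (V := V) (fun t => 2 * t) = negD := by
  ext F t
  simp [negWDeriv, negD]

theorem negWDeriv_one : negWDeriv (V := V) (fun _ => 1) = negDeriv := by
  ext F t
  simp [negWDeriv, negDeriv]

/-- `p` is strictly increasing on `(0, ∞)` with continuous positive derivative `w`. -/
structure IsWeight (p w : ℝ → ℝ) : Prop where
  cont_p : Continuous p
  cont_w : Continuous w
  pos : ∀ t, 0 < t → 0 < w t
  deriv : ∀ t, 0 < t → HasDerivAt p (w t) t
  mono : ∀ t s, 0 < t → t < s → p t < p s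

/-- For $p=t^2$ the operator $-w^{-1}d/dt$ is $-D$, and the iterated integrals are the Erdélyi–Kober
integrals of integer order; the weight $p=t$ below serves the form with ordinary derivatives. -/
theorem isWeight_sq : IsWeight (fun t => t ^ 2) (fun t => 2 * t) where
  cont_p := by fun_prop
  cont_w := by fun_prop
  pos t ht := by positivity
  deriv t _ := by simpa using hasDerivAt_pow 2 t
  mono t s ht hts := by nlinarith

theorem isWeight_id : IsWeight (fun t => t) (fun _ => 1) where
  cont_p := by fun_prop
  cont_w := by fun_prop
  pos t ht := by positivity
  deriv t _ := hasDerivAt_id t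
  mono t s ht hts := hts

variable {p w : ℝ → ℝ}

theorem integral_iterKernel (h : IsWeight p w) (j : ℕ) {t s : ℝ} (ht : 0 < t) (hts : t < s) :
    IntegrableOn (fun r => w r * ((p s - p r) ^ j * w s)) (Ioo t s) ∧
      ∫ r in Ioo t s, w r * ((p s - p r) ^ j * w s) =
        ((j : ℝ) + 1)⁻¹ * ((p s - p t) ^ (j + 1) * w s) := by
  have hc : Continuous fun r => w r * ((p s - p r) ^ j * w s) := by
    have := h.cont_p
    have := h.cont_w
    fun_prop
  refine ⟨(hc.continuousOn.integrableOn_Icc).mono_set Ioo_subset_Icc_self, ?_⟩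
  rw [← integral_Ioc_eq_integral_Ioo, ← intervalIntegral.integral_of_le hts.le]
  have hj : (j : ℝ) + 1 ≠ 0 := by positivity
  have hd : ∀ r ∈ uIcc t s, HasDerivAt
      (fun r => -(((j : ℝ) + 1)⁻¹ * ((p s - p r) ^ (j + 1) * w s)))
      (w r * ((p s - p r) ^ j * w s)) r := by
    intro r hr
    rw [uIcc_of_le hts.le] at hr
    have h1 := (((h.deriv r (ht.trans_le hr.1)).const_sub (p s)).pow (j + 1)).mul_const (w s)
    refine ((h1.const_mul ((j : ℝ) + 1)⁻¹).neg).congr_deriv ?_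
    push_cast
    field_simp
  rw [intervalIntegral.integral_eq_sub_of_hasDerivAt hd (hc.intervalIntegrable _ _)]
  simp

theorem iterInt_succ [CompleteSpace V] (h : IsWeight p w) (j : ℕ) {G : ℝ → V} (hG : ContinuousOn G (Ioi 0)) {t : ℝ}
    (ht : 0 < t)
    (hi : IntegrableOn (fun s => ((p s - p t) ^ (j + 1) * w s) • G s) (Ioi t)) :
    IntegrableOn (fun r => w r • iterInt p w j G r) (Ioi t) ∧
      iterInt p w 0 (iterInt p w j G) t = iterInt p w (j + 1) G t := by
  have hcp := h.cont_p
  have hcw := h.cont_w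
  have key := integral_kernel_comp (A := w) (B := fun r s => (p s - p r) ^ j * w s)
    (K := fun s => ((j : ℝ) + 1)⁻¹ * ((p s - p t) ^ (j + 1) * w s)) (G := G) (t := t)
    hcw.measurable (Continuous.measurable (by simp only [Function.uncurry_def]; fun_prop))
    (fun r hr => (h.pos r (ht.trans hr)).le)
    (fun r s hr hs => mul_nonneg
      (pow_nonneg (sub_nonneg.2 (h.mono r s (ht.trans hr) hs).le) _)
      (h.pos s ((ht.trans hr).trans hs)).le)
    (fun s hs => integral_iterKernel h j ht hs) (aestronglyMeasurable_Ioi hG ht)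
    (by
      simp only [mul_smul]
      simp only [mul_smul] at hi
      exact Integrable.smul (((j : ℝ) + 1)⁻¹) hi)
  have e : ∀ r, w r • iterInt p w j G r =
      ((j.factorial : ℝ)⁻¹) • (w r • ∫ s in Ioi r, ((p s - p r) ^ j * w s) • G s) := by
    intro r
    rw [iterInt, smul_comm]
  refine ⟨?_, ?_⟩
  · simp only [e]
    exact key.1.smul _
  · rw [iterInt]
    simp only [pow_zero, one_mul, Nat.factorial_zero, Nat.cast_one, inv_one, one_smul, e]
    rw [integral_smul, key.2, iterInt]
    have e2 : ∀ s, (((j : ℝ) + 1)⁻¹ * ((p s - p t) ^ (j + 1) * w s)) • G s =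
        ((j : ℝ) + 1)⁻¹ • (((p s - p t) ^ (j + 1) * w s) • G s) := fun s => mul_smul _ _ _
    simp only [e2]
    rw [integral_smul, smul_smul, Nat.factorial_succ]
    congr 1
    push_cast
    rw [mul_inv, mul_comm]

/-- Move the base point from $t$ to $t/2$: for $s>t$ the extra factor $p(s)-p(t/2)$ is at least
$p(t)-p(t/2)>0$, so the kernel of degree $j+1$ at $t/2$ dominates that of degree $j$ at $t$ up to a
constant. -/
theorem integrableOn_iterKernel_pred (h : IsWeight p w) (j : ℕ) {G : ℝ → V}
    (hG : ContinuousOn G (Ioi 0))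
    (hi : ∀ t, 0 < t → IntegrableOn (fun s => ((p s - p t) ^ (j + 1) * w s) • G s) (Ioi t))
    {t : ℝ} (ht : 0 < t) :
    IntegrableOn (fun s => ((p s - p t) ^ j * w s) • G s) (Ioi t) := by
  have hcp := h.cont_p
  have hcw := h.cont_w
  have h2 : 0 < t / 2 := half_pos ht
  have h2t : t / 2 < t := half_lt_self ht
  have hc : 0 < p t - p (t / 2) := sub_pos.2 (h.mono _ _ h2 h2t)
  refine Integrable.mono' ((((hi _ h2).mono_set (Ioi_subset_Ioi h2t.le)).norm).const_mul
    (p t - p (t / 2))⁻¹)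
    ((Measurable.aestronglyMeasurable (by fun_prop)).smul (aestronglyMeasurable_Ioi hG ht)) ?_
  refine (ae_restrict_mem measurableSet_Ioi).mono fun s hs => ?_
  have hs : t < s := hs
  have hw := (h.pos s (ht.trans hs)).le
  have hps := h.mono t s ht hs
  rw [norm_smul, norm_smul, ← mul_assoc]
  refine mul_le_mul_of_nonneg_right ?_ (norm_nonneg _)
  rw [Real.norm_of_nonneg (mul_nonneg (pow_nonneg (by linarith) _) hw),
    Real.norm_of_nonneg (mul_nonneg (pow_nonneg (by linarith) _) hw), ← mul_assoc]
  refine mul_le_mul_of_nonneg_right ?_ hw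
  rw [inv_mul_eq_div, le_div_iff₀ hc, pow_succ]
  exact mul_le_mul (pow_le_pow_left₀ (by linarith) (by linarith) _) (by linarith) hc.le
    (pow_nonneg (by linarith) _)

/-- The differential operator `-w⁻¹ d/dt` inverts the iterated integrals. -/
theorem negWDeriv_iterInt [CompleteSpace V] (h : IsWeight p w) (j : ℕ) {G : ℝ → V} (hG : ContinuousOn G (Ioi 0))
    (hi : ∀ t, 0 < t → IntegrableOn (fun s => ((p s - p t) ^ j * w s) • G s) (Ioi t)) :
    CanIterate (negWDeriv w) (j + 1) (iterInt p w j G) ∧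
      EqOn ((negWDeriv w)^[j + 1] (iterInt p w j G)) G (Ioi 0) := by
  have base : ∀ {H : ℝ → V}, ContinuousOn H (Ioi 0) →
      (∀ t, 0 < t → IntegrableOn (fun s => w s • H s) (Ioi t)) → ∀ t, 0 < t →
      HasDerivAt (iterInt p w 0 H) (-(w t • H t)) t := by
    intro H hH hHi t ht
    have := hasDerivAt_integral_Ioi_tail (h.cont_w.continuousOn.smul hH) hHi ht
    have e : iterInt p w 0 H = fun x => ∫ s in Ioi x, w s • H s := by
      ext x
      simp [iterInt]
    rw [e]
    exact this
  have base_eq : ∀ {H : ℝ → V}, ContinuousOn H (Ioi 0) →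
      (∀ t, 0 < t → IntegrableOn (fun s => w s • H s) (Ioi t)) →
      EqOn (negWDeriv w (iterInt p w 0 H)) H (Ioi 0) := by
    intro H hH hHi t ht
    rw [negWDeriv, (base hH hHi t ht).deriv, smul_neg, neg_neg, smul_smul,
      inv_mul_cancel₀ (h.pos t ht).ne', one_smul]
  induction j with
  | zero =>
    have hi' : ∀ t, 0 < t → IntegrableOn (fun s => w s • G s) (Ioi t) := by simpa using hi
    refine ⟨fun i hi1 => ?_, base_eq hG hi'⟩
    obtain rfl : i = 0 := by omega
    exact fun t ht => (base hG hi' t ht).differentiableAt.differentiableWithinAt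
  | succ j ih =>
    obtain ⟨ih1, ih2⟩ := ih fun t ht => integrableOn_iterKernel_pred h j hG hi ht
    have hHc : ContinuousOn (iterInt p w j G) (Ioi 0) := (ih1 0 (Nat.succ_pos j)).continuousOn
    have hHi : ∀ t, 0 < t → IntegrableOn (fun s => w s • iterInt p w j G s) (Ioi t) :=
      fun t ht => (iterInt_succ h j hG ht (hi t ht)).1
    -- The outermost integral is peeled off: one derivative removes it and leaves the $(j+1)$-fold
    -- integral, to which the induction hypothesis applies.
    have heq : EqOn (iterInt p w 0 (iterInt p w j G)) (iterInt p w (j + 1) G) (Ioi 0) :=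
      fun t ht => (iterInt_succ h j hG ht (hi t ht)).2
    have hstep : EqOn (negWDeriv w (iterInt p w (j + 1) G)) (iterInt p w j G) (Ioi 0) :=
      (iterate_negWDeriv_congr heq 1).symm.trans (base_eq hHc hHi)
    refine ⟨fun i hi1 => ?_, ?_⟩
    · rcases i with _ | i
      · exact DifferentiableOn.congr (fun t ht =>
          (base hHc hHi t ht).differentiableAt.differentiableWithinAt) heq.symm
      · rw [Function.iterate_succ_apply]
        exact (ih1 i (by omega)).congr (iterate_negWDeriv_congr hstep i)
    · rw [Function.iterate_succ_apply]
      exact (iterate_negWDeriv_congr hstep (j + 1)).trans ih2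

end Iterated

/-! ### Inversion of the Erdélyi–Kober integrals -/

section ErdelyiKober

variable {V : Type*} [NormedAddCommGroup V] [NormedSpace ℝ V]

/-- Near $s=t$ the singularity $(s^2-t^2)^{\alpha-1}$ is integrable because $\alpha>0$. For $s>2t$
one has $s^2-t^2\ge\frac34s^2$, so the kernel is at most $\frac43s^{2\alpha-1}$, whatever the sign
of $\alpha-1$. -/
theorem EKConverges.of_weighted {α : ℝ} (hα : 0 < α) {G : ℝ → V} (hG : ContinuousOn G (Ioi 0))
    (hi : IntegrableOn (fun s : ℝ => s ^ (2 * α - 1) • G s) (Ioi 1)) : EKConverges α G := by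
  intro t ht
  set T : ℝ := max 1 (2 * t) with hT
  have htT : t ≤ T := le_trans (by linarith) (le_max_right 1 (2 * t))
  refine integrableOn_kernel_smul hG hi (κ := fun s => (s ^ 2 - t ^ 2) ^ (α - 1) * s)
    (Measurable.mul (by fun_prop) measurable_id) (T := T) (C := 4 / 3) ht htT (le_max_left _ _)
    ?_ ?_
  · have h1 := (integrableOn_Icc_deriv_smul_iff_of_deriv_nonneg (f := fun s => s ^ 2 - t ^ 2)
      (f' := fun s => 2 * s) (g := fun x : ℝ => x ^ (α - 1)) (a := t) (b := T) (by fun_prop)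
      (fun s _ => by simpa using (hasDerivAt_pow 2 s).sub_const (t ^ 2))
      (fun s hs => by have := ht.trans hs.1; positivity) htT).2 (by
        have hle : t ^ 2 - t ^ 2 ≤ T ^ 2 - t ^ 2 := by gcongr
        have := intervalIntegral.intervalIntegrable_rpow' (a := t ^ 2 - t ^ 2)
          (b := T ^ 2 - t ^ 2) (r := α - 1) (by linarith)
        rwa [intervalIntegrable_iff_integrableOn_Icc_of_le hle] at this)
    refine IntegrableOn.congr_fun (h1.const_mul (1 / 2)) (fun s _ => ?_) measurableSet_Icc
    simp only [smul_eq_mul]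
    ring
  · intro s hs
    have hts : 2 * t < s := lt_of_le_of_lt (le_max_right _ _) hs
    have hs0 : 0 < s := by linarith
    have hq : 3 / 4 * s ^ 2 ≤ s ^ 2 - t ^ 2 := by nlinarith
    have hq0 : 0 < s ^ 2 - t ^ 2 := lt_of_lt_of_le (by positivity) hq
    have e2 : (s ^ 2) ^ α = s ^ (2 * α) := by
      rw [← Real.rpow_natCast, ← Real.rpow_mul hs0.le]
      norm_num
    rw [abs_of_nonneg (mul_nonneg (Real.rpow_nonneg hq0.le _) hs0.le), Real.rpow_sub_one hq0.ne',
      Real.rpow_sub_one hs0.ne', div_mul_eq_mul_div, div_le_iff₀ hq0]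
    calc (s ^ 2 - t ^ 2) ^ α * s ≤ (s ^ 2) ^ α * s := by
          gcongr
          nlinarith
      _ = 4 / 3 * (s ^ (2 * α) / s) * (3 / 4 * s ^ 2) := by rw [e2]; field_simp
      _ ≤ _ := by gcongr

theorem integrableOn_sqKernel (m : ℕ) {G : ℝ → V} (hG : ContinuousOn G (Ioi 0))
    (hi : IntegrableOn (fun s : ℝ => s ^ (2 * (m : ℝ) + 1) • G s) (Ioi 1)) {t : ℝ} (ht : 0 < t) :
    IntegrableOn (fun s => ((s ^ 2 - t ^ 2) ^ m * (2 * s)) • G s) (Ioi t) := by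
  have h := EKConverges.of_weighted (α := (m : ℝ) + 1) (by positivity) hG
    (by convert hi using 4; ring) t ht
  refine (h.smul (2 : ℝ)).congr (ae_of_all _ fun s => ?_)
  simp only [Pi.smul_apply, ekIntegrand, add_sub_cancel_right, Real.rpow_natCast, smul_smul]
  congr 1
  ring

theorem ekIntegral_natCast_add_one (m : ℕ) (G : ℝ → V) (t : ℝ) :
    ekIntegral ((m : ℝ) + 1) G t = iterInt (fun t => t ^ 2) (fun t => 2 * t) m G t := by
  have e : ∀ s, ((s ^ 2 - t ^ 2) ^ m * (2 * s)) • G s =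
      (2 : ℝ) • ekIntegrand ((m : ℝ) + 1) G t s := by
    intro s
    simp only [ekIntegrand, add_sub_cancel_right, Real.rpow_natCast, smul_smul]
    congr 1
    ring
  simp only [ekIntegral, iterInt, e]
  rw [integral_smul, smul_smul, Real.Gamma_nat_eq_factorial]
  congr 1
  ring

variable [CompleteSpace V]

/-- The common Fubini step for all compositions $I^\alpha\rho I^\beta$; only the kernel $K$ remains
to be identified. It is used with $\rho=r^{-2(\alpha+\beta)}$, $1$ and $r^{-k-1}$. -/
theorem ekIntegral_weight_comp {α β : ℝ} {ρ K : ℝ → ℝ} (hρ : Measurable ρ)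
    (hρ0 : ∀ r, 0 < r → 0 ≤ ρ r) {F G : ℝ → V} (hG : ContinuousOn G (Ioi 0))
    (hF : ∀ r, 0 < r → F r = ekIntegral β G r) {t : ℝ} (ht : 0 < t)
    (hK : ∀ s, t < s → IntegrableOn (fun r => ((r ^ 2 - t ^ 2) ^ (α - 1) * r * ρ r) *
        ((s ^ 2 - r ^ 2) ^ (β - 1) * s)) (Ioo t s) ∧
      ∫ r in Ioo t s, ((r ^ 2 - t ^ 2) ^ (α - 1) * r * ρ r) *
        ((s ^ 2 - r ^ 2) ^ (β - 1) * s) = K s)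
    (hKG : IntegrableOn (fun s => K s • G s) (Ioi t)) :
    IntegrableOn (ekIntegrand α (fun r => ρ r • F r) t) (Ioi t) ∧
      ekIntegral α (fun r => ρ r • F r) t =
        (2 / Real.Gamma α * (2 / Real.Gamma β)) • ∫ s in Ioi t, K s • G s := by
  have key := integral_kernel_comp (A := fun r => (r ^ 2 - t ^ 2) ^ (α - 1) * r * ρ r)
    (B := fun r s => (s ^ 2 - r ^ 2) ^ (β - 1) * s) (K := K) (G := G) (t := t)
    (by fun_prop) (by simp only [Function.uncurry_def]; fun_prop)
    (fun r hr => mul_nonneg (mul_nonneg (Real.rpow_nonneg (by nlinarith) _) (ht.trans hr).le)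
      (hρ0 r (ht.trans hr)))
    (fun r s hr hs => mul_nonneg (Real.rpow_nonneg (by nlinarith) _) (by linarith)) hK
    (aestronglyMeasurable_Ioi hG ht) hKG
  have e : ∀ r ∈ Ioi t, ekIntegrand α (fun r => ρ r • F r) t r = (2 / Real.Gamma β) •
      (((r ^ 2 - t ^ 2) ^ (α - 1) * r * ρ r) •
        ∫ s in Ioi r, ((s ^ 2 - r ^ 2) ^ (β - 1) * s) • G s) := by
    intro r hr
    simp only [ekIntegrand]
    rw [hF r (ht.trans hr), ekIntegral, smul_smul, smul_comm, smul_smul, smul_smul]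
    simp only [ekIntegrand]
  refine ⟨IntegrableOn.congr_fun (key.1.smul (2 / Real.Gamma β)) (fun r hr => (e r hr).symm)
    measurableSet_Ioi, ?_⟩
  rw [ekIntegral, setIntegral_congr_fun measurableSet_Ioi e, integral_smul, key.2, smul_smul]

/-- `t^{2β} I^α t^{-2(α+β)} I^β G = I^{α+β} t^{-2α} G` for an integer `α + β`. -/
theorem ekIntegral_complemented {α β : ℝ} (hα : 0 < α) (hβ : 0 < β) {m : ℕ}
    (hm : α + β = (m : ℝ) + 1) {F G : ℝ → V} (hG : ContinuousOn G (Ioi 0))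
    (hi : IntegrableOn (fun s : ℝ => s ^ (2 * β - 1) • G s) (Ioi 1))
    (hF : ∀ r, 0 < r → F r = ekIntegral β G r) :
    EKConverges α (powMul (-(2 * (α + β))) F) ∧
    ContinuousOn (powMul (-(2 * α)) G) (Ioi 0) ∧
    (∀ t, 0 < t → IntegrableOn
      (fun s => ((s ^ 2 - t ^ 2) ^ m * (2 * s)) • powMul (-(2 * α)) G s) (Ioi t)) ∧
    ∀ t, 0 < t → powMul (2 * β) (ekIntegral α (powMul (-(2 * (α + β))) F)) t =
      iterInt (fun t => t ^ 2) (fun t => 2 * t) m (powMul (-(2 * α)) G) t := by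
  have hGa := (Real.Gamma_pos_of_pos hα).ne'
  have hGb := (Real.Gamma_pos_of_pos hβ).ne'
  have hHc : ContinuousOn (powMul (-(2 * α)) G) (Ioi 0) :=
    (continuousOn_id.rpow_const fun s hs => Or.inl (ne_of_gt hs)).smul hG
  have hHi : ∀ t, 0 < t → IntegrableOn
      (fun s => ((s ^ 2 - t ^ 2) ^ m * (2 * s)) • powMul (-(2 * α)) G s) (Ioi t) := by
    intro t ht
    -- Since $2m+1-2\alpha=2\beta-1$, the weight $s^{-2\alpha}$ reduces the needed integrability to
    -- that assumed of $G$.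
    refine integrableOn_sqKernel m hHc (hi.congr_fun (fun s hs => ?_) measurableSet_Ioi) ht
    have hs0 : (0 : ℝ) < s := zero_lt_one.trans hs
    simp only [powMul, smul_smul]
    rw [← Real.rpow_add hs0]
    congr 2
    linarith
  have hKG : ∀ t s, ((s ^ 2 - t ^ 2) ^ (α + β - 1) * s / 2 * (s ^ (-(2 * α)) * t ^ (-(2 * β))) *
        (Real.Gamma α * Real.Gamma β / Real.Gamma (α + β))) • G s =
      (t ^ (-(2 * β)) / 4 * (Real.Gamma α * Real.Gamma β / Real.Gamma (α + β))) •
        (((s ^ 2 - t ^ 2) ^ m * (2 * s)) • powMul (-(2 * α)) G s) := by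
    intro t s
    simp only [powMul, smul_smul]
    rw [hm, add_sub_cancel_right, Real.rpow_natCast]
    congr 1
    ring
  have key := fun t (ht : 0 < t) => ekIntegral_weight_comp (α := α) (β := β)
    (ρ := fun r => r ^ (-(2 * (α + β)))) (by fun_prop) (fun r hr => Real.rpow_nonneg hr.le _)
    hG hF ht (fun s hs => ekKernel_comp_weighted hα hβ ht hs)
    (by simp only [hKG]; exact (hHi t ht).smul _)
  refine ⟨fun t ht => (key t ht).1, hHc, hHi, fun t ht => ?_⟩
  have h2 := (key t ht).2
  simp only [hKG] at h2
  rw [integral_smul, smul_smul] at h2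
  rw [powMul]
  change t ^ (2 * β) • ekIntegral α (fun r => r ^ (-(2 * (α + β))) • F r) t = _
  rw [h2, iterInt, smul_smul, hm, Real.Gamma_nat_eq_factorial, Real.rpow_neg ht.le]
  congr 1
  have := (Real.rpow_pos_of_pos ht (2 * β)).ne'
  field_simp
  norm_num

/-- The semigroup property `I^α I^β G = I^{α+β} G` for an integer `α + β`. -/
theorem ekIntegral_semigroup {α β : ℝ} (hα : 0 < α) (hβ : 0 < β) {m : ℕ}
    (hm : α + β = (m : ℝ) + 1) {F G : ℝ → V} (hG : ContinuousOn G (Ioi 0))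
    (hi : IntegrableOn (fun s : ℝ => s ^ (2 * (m : ℝ) + 1) • G s) (Ioi 1))
    (hF : ∀ r, 0 < r → F r = ekIntegral β G r) :
    EKConverges α F ∧
    ∀ t, 0 < t → ekIntegral α F t = iterInt (fun t => t ^ 2) (fun t => 2 * t) m G t := by
  have hGa := (Real.Gamma_pos_of_pos hα).ne'
  have hGb := (Real.Gamma_pos_of_pos hβ).ne'
  have hKG : ∀ t s, ((s ^ 2 - t ^ 2) ^ (α + β - 1) * s / 2 *
        (Real.Gamma α * Real.Gamma β / Real.Gamma (α + β))) • G s =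
      (1 / 4 * (Real.Gamma α * Real.Gamma β / Real.Gamma (α + β))) •
        (((s ^ 2 - t ^ 2) ^ m * (2 * s)) • G s) := by
    intro t s
    simp only [smul_smul]
    rw [hm, add_sub_cancel_right, Real.rpow_natCast]
    congr 1
    ring
  have key := fun t (ht : 0 < t) => ekIntegral_weight_comp (α := α) (β := β)
    (ρ := fun _ => 1) (by fun_prop) (fun r hr => zero_le_one)
    hG hF ht (fun s hs => by simpa only [mul_one] using ekKernel_comp hα hβ ht hs)
    (by simp only [hKG]; exact (integrableOn_sqKernel m hG hi ht).smul _)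
  simp only [one_smul] at key
  refine ⟨fun t ht => (key t ht).1, fun t ht => ?_⟩
  have h2 := (key t ht).2
  simp only [hKG] at h2
  rw [integral_smul, smul_smul] at h2
  refine h2.trans ?_
  rw [iterInt, hm, Real.Gamma_nat_eq_factorial]
  congr 1
  field_simp
  norm_num

/-- `t I^{k/2} t^{-k-1} I^{k/2} G` is the `k`-fold integral of `2^k G`. -/
theorem ekIntegral_ordinary {k : ℕ} (hk : 1 ≤ k) {F G : ℝ → V} (hG : ContinuousOn G (Ioi 0))
    (hi : IntegrableOn (fun s : ℝ => s ^ ((k : ℝ) - 1) • G s) (Ioi 1))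
    (hF : ∀ r, 0 < r → F r = ekIntegral ((k : ℝ) / 2) G r) :
    EKConverges ((k : ℝ) / 2) (powMul (-(k : ℝ) - 1) F) ∧
    (∀ t, 0 < t → IntegrableOn
      (fun s => ((s - t) ^ (k - 1) * 1) • ((2 : ℝ) ^ k • G s)) (Ioi t)) ∧
    ∀ t, 0 < t → powMul 1 (ekIntegral ((k : ℝ) / 2) (powMul (-(k : ℝ) - 1) F)) t =
      iterInt (fun t => t) (fun _ => 1) (k - 1) (fun s => (2 : ℝ) ^ k • G s) t := by
  have hk0 : (0 : ℝ) < k := by exact_mod_cast hk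
  have hb : (0 : ℝ) < (k : ℝ) / 2 := by positivity
  have hGb := (Real.Gamma_pos_of_pos hb).ne'
  have hkk : (k : ℝ) / 2 + (k : ℝ) / 2 = ((k - 1 : ℕ) : ℝ) + 1 := by
    rw [Nat.cast_sub hk]; push_cast; ring
  have hk2 : 2 * ((k : ℝ) / 2) = k := by ring
  -- The factor $4^{a-1}$ of the composed kernel, at $a=k/2$, is the source of the constant $2^k$ in
  -- the final formula.
  have h4 : (4 : ℝ) ^ ((k : ℝ) / 2 - 1) = 2 ^ k / 4 := by
    rw [Real.rpow_sub_one (by norm_num), show (4 : ℝ) = 2 ^ (2 : ℕ) by norm_num,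
      ← Real.rpow_natCast, ← Real.rpow_mul (by norm_num)]
    rw [show ((2 : ℕ) : ℝ) * ((k : ℝ) / 2) = (k : ℝ) by push_cast; ring, Real.rpow_natCast]
  have hHi : ∀ t, 0 < t → IntegrableOn
      (fun s => ((s - t) ^ (k - 1) * 1) • ((2 : ℝ) ^ k • G s)) (Ioi t) := by
    intro t ht
    have h1 : IntegrableOn (fun s => (s - t) ^ (k - 1) • G s) (Ioi t) := by
      refine integrableOn_kernel_smul hG hi (κ := fun s => (s - t) ^ (k - 1)) (by fun_prop)
        (T := max 1 t) (C := 1) ht (le_max_right _ _) (le_max_left _ _)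
        (Continuous.integrableOn_Icc (by fun_prop)) fun s hs => ?_
      have hts : t < s := lt_of_le_of_lt (le_max_right _ _) hs
      rw [abs_of_nonneg (pow_nonneg (by linarith) _), one_mul,
        show (k : ℝ) - 1 = ((k - 1 : ℕ) : ℝ) by rw [Nat.cast_sub hk]; simp, Real.rpow_natCast]
      exact pow_le_pow_left₀ (by linarith) (by linarith) _
    refine (h1.smul ((2 : ℝ) ^ k)).congr (ae_of_all _ fun s => ?_)
    simp only [Pi.smul_apply, mul_one]
    rw [smul_comm]
  have hKG : ∀ t, ∀ s ∈ Ioi t, ((s - t) ^ (2 * ((k : ℝ) / 2) - 1) * 4 ^ ((k : ℝ) / 2 - 1) / t *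
        (Real.Gamma ((k : ℝ) / 2) * Real.Gamma ((k : ℝ) / 2) /
          Real.Gamma ((k : ℝ) / 2 + (k : ℝ) / 2))) • G s =
      (1 / (4 * t) * (Real.Gamma ((k : ℝ) / 2) * Real.Gamma ((k : ℝ) / 2) /
          Real.Gamma ((k : ℝ) / 2 + (k : ℝ) / 2))) •
        (((s - t) ^ (k - 1) * 1) • ((2 : ℝ) ^ k • G s)) := by
    intro t s hs
    simp only [smul_smul]
    rw [hk2, h4, show (k : ℝ) - 1 = ((k - 1 : ℕ) : ℝ) by rw [Nat.cast_sub hk]; simp,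
      Real.rpow_natCast]
    congr 1
    field_simp
  have key := fun t (ht : 0 < t) => ekIntegral_weight_comp (α := (k : ℝ) / 2) (β := (k : ℝ) / 2)
    (ρ := fun r => r ^ (-(k : ℝ) - 1)) (by fun_prop) (fun r hr => Real.rpow_nonneg hr.le _)
    hG hF ht (fun s hs => by
      have := ekKernel_comp_ordinary hb ht hs
      rw [show -(2 * ((k : ℝ) / 2)) - 1 = -(k : ℝ) - 1 by ring] at this
      exact this)
    (IntegrableOn.congr_fun ((hHi t ht).smul _) (fun s hs => (hKG t s hs).symm) measurableSet_Ioi)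
  refine ⟨fun t ht => (key t ht).1, hHi, fun t ht => ?_⟩
  have h2 := (key t ht).2
  rw [setIntegral_congr_fun measurableSet_Ioi (hKG t), integral_smul, smul_smul] at h2
  rw [powMul]
  change t ^ (1 : ℝ) • ekIntegral ((k : ℝ) / 2) (fun r => r ^ (-(k : ℝ) - 1) • F r) t = _
  rw [h2, iterInt, smul_smul, hkk, Real.Gamma_nat_eq_factorial, Real.rpow_one]
  congr 1
  field_simp
  norm_num

/-- The inversion formula for even `k`. -/
theorem IsEKDerivative.even_form {k : ℕ} (hk : 1 ≤ k) (hke : Even k) {F G : ℝ → V}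
    (h : IsEKDerivative ((k : ℝ) / 2) F G) :
    CanIterate negD (k / 2) F ∧ ∀ t, 0 < t → G t = (negD^[k / 2] F) t := by
  -- The shift by one matches `iterInt`, whose index $m$ stands for an $(m+1)$-fold integral.
  obtain ⟨m, rfl⟩ : ∃ m, k = 2 * (m + 1) := by
    obtain ⟨j, rfl⟩ := hke
    exact ⟨j - 1, by omega⟩
  have e1 : ((2 * (m + 1) : ℕ) : ℝ) / 2 = (m : ℝ) + 1 := by push_cast; ring
  have e2 : 2 * (m + 1) / 2 = m + 1 := by omega
  rw [e1] at h
  rw [e2, ← negWDeriv_two_mul]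
  have heq : EqOn (iterInt (fun t => t ^ 2) (fun t => 2 * t) m G) F (Ioi 0) := fun t ht => by
    rw [h.eq_integral t ht, ekIntegral_natCast_add_one]
  obtain ⟨c1, c2⟩ := negWDeriv_iterInt isWeight_sq m h.continuousOn fun t ht =>
    integrableOn_sqKernel m h.continuousOn (by convert h.integrableOn using 4; ring) ht
  exact ⟨c1.congr heq, fun t ht => (c2 ht).symm.trans (iterate_negWDeriv_congr heq _ ht)⟩

/-- This order complements $k/2$ to the integer $m+1$: it equals 1 for even $k$ and $1/2$ for odd
$k$. -/
theorem order_pos (k : ℕ) : 0 < 1 - (k : ℝ) / 2 + ((k / 2 : ℕ) : ℝ) := by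
  have h : k < 2 * (k / 2) + 2 := by omega
  have h' : (k : ℝ) < 2 * ((k / 2 : ℕ) : ℝ) + 2 := by exact_mod_cast h
  linarith

/-- The complemented inversion formula. -/
theorem IsEKDerivative.complemented_form {k : ℕ} (hk : 1 ≤ k) {F G : ℝ → V}
    (h : IsEKDerivative ((k : ℝ) / 2) F G) :
    EKConverges (1 - (k : ℝ) / 2 + ((k / 2 : ℕ) : ℝ)) (powMul (-2 * ((k / 2 : ℕ) : ℝ) - 2) F) ∧
    CanIterate negD (k / 2 + 1) (powMul (k : ℝ) (psi k F)) ∧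
    ∀ t : ℝ, 0 < t → G t = complementedForm k F t := by
  have hk0 : (0 : ℝ) < k := by exact_mod_cast hk
  obtain ⟨c1, c2, c3, c4⟩ := ekIntegral_complemented (order_pos k)
    (show (0 : ℝ) < (k : ℝ) / 2 by positivity) (m := k / 2) (by ring) h.continuousOn
    h.integrableOn h.eq_integral
  have e1 : -(2 * (1 - (k : ℝ) / 2 + ((k / 2 : ℕ) : ℝ) + (k : ℝ) / 2)) =
      -2 * ((k / 2 : ℕ) : ℝ) - 2 := by ring
  have e2 : 2 * ((k : ℝ) / 2) = k := by ring
  rw [e1] at c1 c4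
  rw [e2] at c4
  have heq : EqOn (iterInt (fun t => t ^ 2) (fun t => 2 * t) (k / 2)
      (powMul (-(2 * (1 - (k : ℝ) / 2 + ((k / 2 : ℕ) : ℝ)))) G)) (powMul (k : ℝ) (psi k F))
      (Ioi 0) := fun t ht => (c4 t ht).symm
  obtain ⟨d1, d2⟩ := negWDeriv_iterInt isWeight_sq (k / 2) c2 c3
  rw [negWDeriv_two_mul] at d2
  rw [← negWDeriv_two_mul]
  refine ⟨c1, d1.congr heq, fun t ht => ?_⟩
  have d3 := (d2 ht).symm.trans
    (negWDeriv_two_mul (V := V) ▸ iterate_negWDeriv_congr (w := fun t => 2 * t) heq _ ht)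
  rw [complementedForm, powMul, ← d3, powMul, smul_smul, ← Real.rpow_add ht]
  rw [show 2 - (k : ℝ) + 2 * ((k / 2 : ℕ) : ℝ) +
    -(2 * (1 - (k : ℝ) / 2 + ((k / 2 : ℕ) : ℝ))) = 0 by ring, Real.rpow_zero, one_smul]

/-- The inversion formula with ordinary derivatives. -/
theorem IsEKDerivative.ordinary_form {k : ℕ} (hk : 1 ≤ k) {F G : ℝ → V}
    (h : IsEKDerivative ((k : ℝ) / 2) F G) :
    EKConverges ((k : ℝ) / 2) (powMul (-(k : ℝ) - 1) F) ∧
    CanIterate negDeriv k (powMul 1 (ekIntegral ((k : ℝ) / 2) (powMul (-(k : ℝ) - 1) F))) ∧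
    ∀ t : ℝ, 0 < t → G t = ordinaryForm k F t := by
  obtain ⟨c1, c2, c3⟩ := ekIntegral_ordinary hk h.continuousOn
    (by convert h.integrableOn using 4; ring) h.eq_integral
  have heq : EqOn (iterInt (fun t => t) (fun _ => 1) (k - 1) (fun s => (2 : ℝ) ^ k • G s))
      (powMul 1 (ekIntegral ((k : ℝ) / 2) (powMul (-(k : ℝ) - 1) F))) (Ioi 0) :=
    fun t ht => (c3 t ht).symm
  obtain ⟨d1, d2⟩ := negWDeriv_iterInt isWeight_id (k - 1)
    (h.continuousOn.const_smul ((2 : ℝ) ^ k)) c2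
  rw [Nat.sub_add_cancel hk] at d1 d2
  refine ⟨c1, negWDeriv_one (V := V) ▸ d1.congr heq, fun t ht => ?_⟩
  have d3 := (d2 ht).symm.trans (iterate_negWDeriv_congr heq k ht)
  rw [negWDeriv_one] at d3
  rw [ordinaryForm, ← d3, Pi.smul_apply, smul_smul, inv_mul_cancel₀ (by positivity), one_smul]

/-- The standard inversion formula. -/
theorem IsEKDerivative.standard_form {k : ℕ} (hk : 1 ≤ k) {F G : ℝ → V}
    (h : IsEKDerivative ((k : ℝ) / 2) F G)
    (hi : IntegrableOn (fun s : ℝ => s ^ (2 * ((k / 2 : ℕ) : ℝ) + 1) • G s) (Ioi 1)) :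
    EKConverges (1 - (k : ℝ) / 2 + ((k / 2 : ℕ) : ℝ)) F ∧
    CanIterate negD (k / 2 + 1) (ekIntegral (1 - (k : ℝ) / 2 + ((k / 2 : ℕ) : ℝ)) F) ∧
    ∀ t : ℝ, 0 < t → G t = standardForm k F t := by
  have hk0 : (0 : ℝ) < k := by exact_mod_cast hk
  obtain ⟨c1, c2⟩ := ekIntegral_semigroup (order_pos k)
    (show (0 : ℝ) < (k : ℝ) / 2 by positivity) (m := k / 2) (by ring) h.continuousOn hi
    h.eq_integral
  have heq : EqOn (iterInt (fun t => t ^ 2) (fun t => 2 * t) (k / 2) G)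
      (ekIntegral (1 - (k : ℝ) / 2 + ((k / 2 : ℕ) : ℝ)) F) (Ioi 0) := fun t ht => (c2 t ht).symm
  obtain ⟨d1, d2⟩ := negWDeriv_iterInt isWeight_sq (k / 2) h.continuousOn
    fun t ht => integrableOn_sqKernel (k / 2) h.continuousOn hi ht
  refine ⟨c1, negWDeriv_two_mul (V := V) ▸ d1.congr heq, fun t ht => ?_⟩
  have d3 := (d2 ht).symm.trans (iterate_negWDeriv_congr heq _ ht)
  rw [negWDeriv_two_mul] at d3
  exact d3

/-- Uniqueness of the Erdélyi–Kober derivative. -/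
theorem IsEKDerivative.eqOn {k : ℕ} (hk : 1 ≤ k) {F G G' : ℝ → V}
    (h : IsEKDerivative ((k : ℝ) / 2) F G) (h' : IsEKDerivative ((k : ℝ) / 2) F G') :
    EqOn G G' (Ioi 0) := fun t ht =>
  -- Both candidates equal the same expression in $F$.
  ((h.complemented_form hk).2.2 t ht).trans ((h'.complemented_form hk).2.2 t ht).symm

end ErdelyiKober

/-! ### Rotations -/

section Rotations

instance SO.instSecondCountableTopology (n : ℕ) : SecondCountableTopology (SO n) :=
  haveI : SecondCountableTopology (Matrix (Fin n) (Fin n) ℝ) :=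
    inferInstanceAs (SecondCountableTopology (Fin n → Fin n → ℝ))
  TopologicalSpace.Subtype.secondCountableTopology _

instance haarSO.instIsProbabilityMeasure (n : ℕ) : IsProbabilityMeasure (haarSO n) :=
  ⟨Measure.haarMeasure_self⟩

instance haarSO.instIsHaarMeasure (n : ℕ) : (haarSO n).IsHaarMeasure :=
  Measure.isHaarMeasure_haarMeasure _

/-- A right translate of the Haar measure is again a left Haar probability measure, so uniqueness
applies. -/
instance haarSO.instIsMulRightInvariant (n : ℕ) : (haarSO n).IsMulRightInvariant where
  map_mul_right_eq_self g := by
    have : IsProbabilityMeasure (Measure.map (fun γ => γ * g) (haarSO n)) :=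
      Measure.isProbabilityMeasure_map (measurable_mul_const g).aemeasurable
    exact Measure.isHaarMeasure_eq_of_isProbabilityMeasure _ _

/-- The action of a rotation on `ℝⁿ`, as a linear isometry. -/
def SO.toLinearIsometry {n : ℕ} (γ : SO n) :
    EuclideanSpace ℝ (Fin n) →ₗᵢ[ℝ] EuclideanSpace ℝ (Fin n) where
  toLinearMap := Matrix.toEuclideanLin γ.1
  norm_map' v := by
    have hγ : star γ.1 * γ.1 = 1 :=
      Matrix.mem_unitaryGroup_iff'.1 (Matrix.mem_specialOrthogonalGroup_iff.1 γ.2).1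
    have h : (Matrix.toEuclideanLin γ.1).adjoint (Matrix.toEuclideanLin γ.1 v) = v := by
      rw [← Matrix.toEuclideanLin_conjTranspose_eq_adjoint, ← Matrix.star_eq_conjTranspose,
        ← LinearMap.comp_apply, ← Matrix.toLpLin_mul_same, hγ, Matrix.toLpLin_one]
      rfl
    rw [← sq_eq_sq₀ (norm_nonneg _) (norm_nonneg _), ← real_inner_self_eq_norm_sq,
      ← real_inner_self_eq_norm_sq, ← LinearMap.adjoint_inner_left, h]

theorem SO.toLinearIsometry_apply {n : ℕ} (γ : SO n) (v : EuclideanSpace ℝ (Fin n)) :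
    γ.toLinearIsometry v = Matrix.toEuclideanLin γ.1 v := rfl

theorem SO.toLinearIsometry_mul {n : ℕ} (γ δ : SO n) (v : EuclideanSpace ℝ (Fin n)) :
    (γ * δ).toLinearIsometry v = γ.toLinearIsometry (δ.toLinearIsometry v) := by
  simp only [SO.toLinearIsometry_apply]
  rw [← LinearMap.comp_apply, ← Matrix.toLpLin_mul_same]
  rfl

theorem SO.continuous_action (n : ℕ) :
    Continuous fun p : SO n × EuclideanSpace ℝ (Fin n) => p.1.toLinearIsometry p.2 := by
  simp only [SO.toLinearIsometry_apply, Matrix.toLpLin_apply]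
  refine (PiLp.continuous_toLp 2 _).comp ?_
  exact (continuous_subtype_val.comp continuous_fst).matrix_mulVec
    ((PiLp.continuous_ofLp 2 _).comp continuous_snd)

theorem norm_lastVec {n : ℕ} (hn : 0 < n) : ‖lastVec n‖ = 1 := by
  have : lastVec n = EuclideanSpace.single ⟨n - 1, by omega⟩ (1 : ℝ) := by
    ext i
    simp only [lastVec, PiLp.single_apply, Fin.ext_iff]
    congr 1
    simp only [eq_iff_iff]
    omega
  rw [this]
  simp

/-- The reflection exchanging $e_n$ and $u$ is orthogonal. If its determinant is $-1$, it is
precomposed with the sign change of $e_1$, which fixes $e_n$ because $n\ge2$. -/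
theorem SO.exists_map_lastVec {n : ℕ} (hn : 2 ≤ n) {u : EuclideanSpace ℝ (Fin n)} (hu : ‖u‖ = 1) :
    ∃ γ : SO n, γ.toLinearIsometry (lastVec n) = u := by
  set Q := (Submodule.span ℝ {lastVec n - u})ᗮ.reflection with hQ
  have hQe : Q (lastVec n) = u := Submodule.reflection_sub (by rw [hu, norm_lastVec (by omega)])
  set b := EuclideanSpace.basisFun (Fin n) ℝ with hb
  set A : Matrix (Fin n) (Fin n) ℝ := LinearMap.toMatrix b.toBasis b.toBasis Q.toLinearMap with hA
  have hAu : A ∈ Matrix.orthogonalGroup (Fin n) ℝ := Q.toMatrix_mem_unitaryGroup b b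
  have hAe : Matrix.toEuclideanLin A (lastVec n) = u := by
    rw [Matrix.toEuclideanLin_eq_toLin_orthonormal, hA, Matrix.toLin_toMatrix]
    exact hQe
  have hdet : A.det = 1 ∨ A.det = -1 := by
    have h := congrArg Matrix.det ((Matrix.mem_orthogonalGroup_iff _ _).1 hAu)
    rw [Matrix.det_mul, Matrix.det_transpose, Matrix.det_one] at h
    exact mul_self_eq_one_iff.1 h
  rcases hdet with h | h
  · exact ⟨⟨A, Matrix.mem_specialOrthogonalGroup_iff.2 ⟨hAu, h⟩⟩, hAe⟩
  · set i0 : Fin n := ⟨0, by omega⟩ with hi0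
    set d : Fin n → ℝ := fun i => if i = i0 then -1 else 1 with hd
    have hDu : Matrix.diagonal d ∈ Matrix.orthogonalGroup (Fin n) ℝ := by
      rw [Matrix.mem_orthogonalGroup_iff, Matrix.diagonal_transpose, Matrix.diagonal_mul_diagonal, ← Matrix.diagonal_one]
      congr 1
      ext i
      by_cases hi : i = i0 <;> simp [hd, hi]
    have hDdet : (Matrix.diagonal d).det = -1 := by
      rw [Matrix.det_diagonal, hd, Finset.prod_ite_eq' Finset.univ i0 (fun _ => (-1 : ℝ))]
      simp
    refine ⟨⟨A * Matrix.diagonal d, Matrix.mem_specialOrthogonalGroup_iff.2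
      ⟨mul_mem hAu hDu, by rw [Matrix.det_mul, h, hDdet]; norm_num⟩⟩, ?_⟩
    rw [SO.toLinearIsometry_apply]
    simp only
    rw [Matrix.toLpLin_mul_same, LinearMap.comp_apply]
    have hDe : Matrix.toEuclideanLin (Matrix.diagonal d) (lastVec n) = lastVec n := by
      ext i
      simp only [Matrix.toLpLin_apply, Matrix.mulVec_diagonal, lastVec, hd]
      by_cases hi : i = i0
      · have : ¬ ((i : ℕ) + 1 = n) := by rw [hi]; simp [hi0]; omega
        simp [this]
      · simp [hi]
    rw [hDe, hAe]

variable {n : ℕ} {V : Type*} [NormedAddCommGroup V] [NormedSpace ℝ V]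

/-- The average of `f` over the sphere of radius `ρ` centred at `x`. -/
def sphMean (f : EuclideanSpace ℝ (Fin n) → V) (x : EuclideanSpace ℝ (Fin n)) (ρ : ℝ) : V :=
  ∫ γ : SO n, f (x + ρ • γ.toLinearIsometry (lastVec n)) ∂(haarSO n)

/-- Write $v=\|v\|\,\delta e_n$ with a rotation $\delta$, which right invariance of the measure
absorbs. Only the length of $v$ survives. -/
theorem integral_rotation (hn : 2 ≤ n) (f : EuclideanSpace ℝ (Fin n) → V)
    (x v : EuclideanSpace ℝ (Fin n)) :
    ∫ γ : SO n, f (x + γ.toLinearIsometry v) ∂(haarSO n) = sphMean f x ‖v‖ := by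
  obtain ⟨δ, hδ⟩ : ∃ δ : SO n, v = ‖v‖ • δ.toLinearIsometry (lastVec n) := by
    rcases eq_or_ne v 0 with rfl | hv
    · exact ⟨1, by simp⟩
    · obtain ⟨δ, hδ⟩ := SO.exists_map_lastVec hn (u := ‖v‖⁻¹ • v) (norm_smul_inv_norm hv)
      refine ⟨δ, ?_⟩
      rw [hδ, smul_smul, mul_inv_cancel₀ (norm_ne_zero_iff.2 hv), one_smul]
  rw [sphMean, ← integral_mul_right_eq_self
    (fun γ : SO n => f (x + ‖v‖ • γ.toLinearIsometry (lastVec n))) δ]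
  congr 1 with γ
  conv_lhs => rw [hδ]
  rw [map_smul, SO.toLinearIsometry_mul]

theorem continuous_sphMean {f : EuclideanSpace ℝ (Fin n) → V} (hf : Continuous f)
    (x : EuclideanSpace ℝ (Fin n)) : Continuous (sphMean f x) := by
  have h := continuous_parametric_integral_of_continuous (μ := haarSO n)
    (f := fun (ρ : ℝ) (γ : SO n) => f (x + ρ • γ.toLinearIsometry (lastVec n)))
    (by
      refine hf.comp (continuous_const.add (continuous_fst.smul ?_))
      exact (SO.continuous_action n).comp (continuous_snd.prodMk continuous_const)) isCompact_univ
  simp only [Measure.restrict_univ] at h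
  exact h

end Rotations

/-! ### Functions with polynomial decay -/

section Decay

variable {n : ℕ} {V : Type*} [NormedAddCommGroup V]

theorem IsCmu.exists_bound {μ : ℝ} (hμ : 0 < μ) {f : EuclideanSpace ℝ (Fin n) → V}
    (hf : IsCmu μ f) : ∃ C, 0 ≤ C ∧ ∀ y, ‖f y‖ ≤ C * (1 + ‖y‖) ^ (-μ) := by
  obtain ⟨c, hc0, hc⟩ := hf.2.exists_nonneg
  obtain ⟨K, hK, hKc⟩ := mem_cocompact.1 hc.bound
  -- Adding the unit ball ensures $\|y\|>1$ outside, so that $1+\|y\|\le2\|y\|$; this is where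
  -- $2^\mu$ comes from.
  have hK' : IsCompact (K ∪ Metric.closedBall 0 1) := hK.union (isCompact_closedBall _ _)
  obtain ⟨B, hB⟩ := hK'.bddAbove_image (f := fun y => ‖f y‖ * (1 + ‖y‖) ^ μ)
    (hf.1.norm.mul (Continuous.rpow_const (by fun_prop) fun y => Or.inr hμ.le)).continuousOn
  refine ⟨max 0 (max B (c * 2 ^ μ)), le_max_left _ _, fun y => ?_⟩
  have h1 : 0 < 1 + ‖y‖ := by positivity
  have h2 : 0 < (1 + ‖y‖) ^ μ := Real.rpow_pos_of_pos h1 _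
  rw [Real.rpow_neg h1.le, ← div_eq_mul_inv, le_div_iff₀ h2]
  by_cases hy : y ∈ K ∪ Metric.closedBall 0 1
  · exact le_max_of_le_right (le_max_of_le_left (hB (mem_image_of_mem _ hy)))
  · refine le_max_of_le_right (le_max_of_le_right ?_)
    simp only [mem_union, not_or, Metric.mem_closedBall, dist_zero_right, not_le] at hy
    have h3 : ‖f y‖ ≤ c * ‖‖y‖ ^ (-μ)‖ := hKc hy.1
    have hy0 : 0 < ‖y‖ := by linarith [hy.2]
    have h4 := Real.rpow_pos_of_pos hy0 μ
    rw [Real.norm_of_nonneg (by positivity), Real.rpow_neg hy0.le] at h3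
    calc ‖f y‖ * (1 + ‖y‖) ^ μ ≤ (c * (‖y‖ ^ μ)⁻¹) * (2 * ‖y‖) ^ μ := by
          gcongr
          linarith [hy.2]
      _ = c * 2 ^ μ := by
          rw [Real.mul_rpow (by norm_num) hy0.le]
          field_simp

/-- Peetre's inequality $1+\|v\|\le(1+\|x\|)(1+\|x+v\|)$ makes the decay bound independent of the
centre, up to a constant. -/
theorem norm_add_le_of_bound {μ C : ℝ} (hμ : 0 < μ) (hC : 0 ≤ C)
    {f : EuclideanSpace ℝ (Fin n) → V} (hf : ∀ y, ‖f y‖ ≤ C * (1 + ‖y‖) ^ (-μ))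
    (x v : EuclideanSpace ℝ (Fin n)) :
    ‖f (x + v)‖ ≤ C * (1 + ‖x‖) ^ μ * (1 + ‖v‖) ^ (-μ) := by
  refine (hf _).trans ?_
  rw [mul_assoc]
  refine mul_le_mul_of_nonneg_left ?_ hC
  have h0 : 0 < 1 + ‖x + v‖ := by positivity
  have h1 : 0 < 1 + ‖x‖ := by positivity
  have h2 : 0 < 1 + ‖v‖ := by positivity
  rw [Real.rpow_neg h0.le, Real.rpow_neg h2.le, inv_eq_one_div, ← div_eq_mul_inv,
    div_le_div_iff₀ (Real.rpow_pos_of_pos h0 _) (Real.rpow_pos_of_pos h2 _), one_mul,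
    ← Real.mul_rpow h1.le h0.le]
  refine Real.rpow_le_rpow h2.le ?_ hμ.le
  have h3 : ‖v‖ ≤ ‖x + v‖ + ‖x‖ := by
    calc ‖v‖ = ‖(x + v) - x‖ := by simp
      _ ≤ _ := norm_sub_le _ _
  nlinarith [norm_nonneg x, norm_nonneg (x + v)]

theorem IsCmu.uniformContinuous {μ : ℝ} (hμ : 0 < μ) {f : EuclideanSpace ℝ (Fin n) → V}
    (hf : IsCmu μ f) : UniformContinuous f := by
  refine hf.1.uniformContinuous_of_tendsto_cocompact (x := 0) (hf.2.trans_tendsto ?_)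
  exact (tendsto_rpow_neg_atTop hμ).comp tendsto_norm_cocompact_atTop

end Decay

/-! ### The `k`-plane transform and its shifted dual -/

section Planes

variable {n : ℕ} {V : Type*} [NormedAddCommGroup V]

theorem isometry_affine {k : ℕ} (p : EuclideanSpace ℝ (Fin n))
    (L : EuclideanSpace ℝ (Fin k) →ₗᵢ[ℝ] EuclideanSpace ℝ (Fin n)) :
    Isometry fun y => p + L y :=
  (isometry_add_left p).comp L.isometry

/-- The normalized Hausdorff measure is transported by isometries, so integrals over a plane become
Lebesgue integrals over $\mathbb R^k$. -/
theorem restrict_range_affine {k : ℕ} (p : EuclideanSpace ℝ (Fin n))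
    (L : EuclideanSpace ℝ (Fin k) →ₗᵢ[ℝ] EuclideanSpace ℝ (Fin n)) :
    (μHE[k] : Measure (EuclideanSpace ℝ (Fin n))).restrict (range fun y => p + L y) =
      (volume : Measure (EuclideanSpace ℝ (Fin k))).map fun y => p + L y := by
  rw [← (isometry_affine p L).map_euclideanHausdorffMeasure,
    EuclideanSpace.euclideanHausdorffMeasure_eq_volume]

theorem measurableEmbedding_affine {k : ℕ} (p : EuclideanSpace ℝ (Fin n))
    (L : EuclideanSpace ℝ (Fin k) →ₗᵢ[ℝ] EuclideanSpace ℝ (Fin n)) :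
    MeasurableEmbedding fun y => p + L y :=
  (isometry_affine p L).isClosedEmbedding.measurableEmbedding

theorem integrable_affine {k : ℕ} {μ : ℝ} (hμ : (k : ℝ) < μ) (hμ0 : 0 < μ)
    {f : EuclideanSpace ℝ (Fin n) → V} (hf : IsCmu μ f) (p : EuclideanSpace ℝ (Fin n))
    (L : EuclideanSpace ℝ (Fin k) →ₗᵢ[ℝ] EuclideanSpace ℝ (Fin n)) :
    Integrable fun y => f (p + L y) := by
  obtain ⟨C, hC, hb⟩ := hf.exists_bound hμ0
  refine Integrable.mono' ((integrable_one_add_norm (E := EuclideanSpace ℝ (Fin k))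
    (μ := volume) (r := μ) (by simpa using hμ)).const_mul (C * (1 + ‖p‖) ^ μ))
    (hf.1.comp (isometry_affine p L).continuous).aestronglyMeasurable (ae_of_all _ fun y => ?_)
  simpa only [LinearIsometry.norm_map] using norm_add_le_of_bound hμ0 hC hb p (L y)

theorem exists_affine_parametrization {k : ℕ} (hk : 1 ≤ k)
    (τ : AffineSubspace ℝ (EuclideanSpace ℝ (Fin n))) (hτ : Module.finrank ℝ τ.direction = k) :
    ∃ (p : EuclideanSpace ℝ (Fin n))
      (L : EuclideanSpace ℝ (Fin k) →ₗᵢ[ℝ] EuclideanSpace ℝ (Fin n)),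
      (τ : Set (EuclideanSpace ℝ (Fin n))) = range fun y => p + L y := by
  -- The empty affine subspace has a direction of dimension 0, so $k\ge1$ excludes it.
  have hne : (τ : Set (EuclideanSpace ℝ (Fin n))).Nonempty := by
    rw [nonempty_iff_ne_empty]
    intro h
    rw [AffineSubspace.coe_eq_bot_iff] at h
    rw [h, AffineSubspace.direction_bot, finrank_bot] at hτ
    omega
  obtain ⟨p, hp⟩ := hne
  let e := ((stdOrthonormalBasis ℝ τ.direction).reindex (finCongr hτ)).repr.symm
  refine ⟨p, τ.direction.subtypeₗᵢ.comp e.toLinearIsometry, ?_⟩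
  ext q
  simp only [SetLike.mem_coe, mem_range]
  constructor
  · intro hq
    refine ⟨e.symm ⟨q - p, AffineSubspace.vsub_mem_direction hq hp⟩, ?_⟩
    simp
  · rintro ⟨y, rfl⟩
    have := AffineSubspace.vadd_mem_of_mem_direction (e y).2 hp
    rwa [vadd_eq_add, add_comm] at this

/-- The inclusion of `ℝ^k` into `ℝⁿ` as the span of the first `k` coordinate vectors. -/
theorem exists_coord_inclusion {k : ℕ} (hkn : k < n) :
    ∃ L : EuclideanSpace ℝ (Fin k) →ₗᵢ[ℝ] EuclideanSpace ℝ (Fin n),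
      LinearMap.range L.toLinearMap = coordSubspace n k ∧
      ∀ y, inner ℝ (L y) (lastVec n) = 0 := by
  set b : Fin k → EuclideanSpace ℝ (Fin n) :=
    fun i => EuclideanSpace.single (Fin.castLE hkn.le i) (1 : ℝ) with hb
  have hon : Orthonormal ℝ b :=
    (EuclideanSpace.orthonormal_single (𝕜 := ℝ) (ι := Fin n)).comp _
      (Fin.castLE_injective hkn.le)
  set c := (EuclideanSpace.basisFun (Fin k) ℝ) with hc
  let Lm : EuclideanSpace ℝ (Fin k) →ₗ[ℝ] EuclideanSpace ℝ (Fin n) := c.toBasis.constr ℝ b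
  have hLc : ∀ i, Lm (c i) = b i := fun i => by
    have := c.toBasis.constr_basis ℝ b i
    rwa [OrthonormalBasis.coe_toBasis] at this
  have hLon : Orthonormal ℝ (Lm ∘ c.toBasis) := by
    have : Lm ∘ c.toBasis = b := by
      ext1 i
      simpa using hLc i
    rw [this]
    exact hon
  let L := Lm.isometryOfOrthonormal (v := c.toBasis) (by simp [c.orthonormal]) hLon
  have hLb : ∀ i, L (c i) = b i := hLc
  have hspan : LinearMap.range L.toLinearMap = coordSubspace n k := by
    rw [← Submodule.map_top, ← c.toBasis.span_eq, Submodule.map_span, coordSubspace]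
    congr 1
    ext v
    constructor
    · rintro ⟨_, ⟨i, rfl⟩, rfl⟩
      refine ⟨Fin.castLE hkn.le i, by simp, ?_⟩
      exact (OrthonormalBasis.coe_toBasis c).symm ▸ (hLb i).symm
    · rintro ⟨i, hi, rfl⟩
      refine ⟨_, ⟨⟨i, hi⟩, rfl⟩, ?_⟩
      exact (OrthonormalBasis.coe_toBasis c).symm ▸ hLb ⟨i, hi⟩
  refine ⟨L, hspan, fun y => ?_⟩
  have hle : coordSubspace n k ≤ (Submodule.span ℝ {lastVec n})ᗮ := by
    rw [coordSubspace, Submodule.span_le]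
    rintro _ ⟨i, hi, rfl⟩
    rw [SetLike.mem_coe, Submodule.mem_orthogonal_singleton_iff_inner_left]
    have hi : (i : ℕ) < k := hi
    have : ¬ ((i : ℕ) + 1 = n) := by omega
    simp [lastVec, EuclideanSpace.inner_single_left, this]
  rw [← Submodule.mem_orthogonal_singleton_iff_inner_left]
  exact hle (hspan ▸ LinearMap.mem_range_self _ y)

theorem shiftedPlane_eq_range {k : ℕ} {L : EuclideanSpace ℝ (Fin k) →ₗᵢ[ℝ] EuclideanSpace ℝ (Fin n)}
    (hL : LinearMap.range L.toLinearMap = coordSubspace n k) (x : EuclideanSpace ℝ (Fin n)) (r : ℝ)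
    (γ : SO n) : (shiftedPlane k x r γ : Set (EuclideanSpace ℝ (Fin n))) =
      range fun y => (x + r • γ.toLinearIsometry (lastVec n)) + γ.toLinearIsometry.comp L y := by
  ext q
  rw [shiftedPlane, SetLike.mem_coe, AffineSubspace.mem_mk', ← hL]
  simp only [Submodule.mem_map, LinearMap.mem_range, mem_range]
  constructor
  · rintro ⟨_, ⟨y, rfl⟩, hy⟩
    refine ⟨y, ?_⟩
    rw [vsub_eq_sub, eq_sub_iff_add_eq'] at hy
    exact hy
  · rintro ⟨y, rfl⟩
    refine ⟨_, ⟨y, rfl⟩, ?_⟩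
    rw [vsub_eq_sub, eq_sub_iff_add_eq']
    rfl

theorem kPlaneTransform_shiftedPlane [NormedSpace ℝ V] {k : ℕ}
    {L : EuclideanSpace ℝ (Fin k) →ₗᵢ[ℝ] EuclideanSpace ℝ (Fin n)}
    (hL : LinearMap.range L.toLinearMap = coordSubspace n k)
    (f : EuclideanSpace ℝ (Fin n) → V) (x : EuclideanSpace ℝ (Fin n)) (r : ℝ) (γ : SO n) :
    kPlaneTransform k f (shiftedPlane k x r γ) =
      ∫ y, f (x + γ.toLinearIsometry (L y + r • lastVec n)) := by
  rw [kPlaneTransform, shiftedPlane_eq_range hL, restrict_range_affine,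
    (measurableEmbedding_affine _ _).integral_map]
  congr 1 with y
  congr 1
  rw [map_add, map_smul]
  change x + r • _ + γ.toLinearIsometry (L y) = _
  abel

theorem norm_incl_add {k : ℕ} (hn : 0 < n)
    {L : EuclideanSpace ℝ (Fin k) →ₗᵢ[ℝ] EuclideanSpace ℝ (Fin n)}
    (hL : ∀ y, inner ℝ (L y) (lastVec n) = 0) (y : EuclideanSpace ℝ (Fin k)) (r : ℝ) :
    ‖L y + r • lastVec n‖ = √(‖y‖ ^ 2 + r ^ 2) := by
  rw [← Real.sqrt_sq (norm_nonneg (L y + r • lastVec n)), norm_add_sq_real, inner_smul_right, hL,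
    norm_smul, norm_lastVec hn, LinearIsometry.norm_map]
  simp

/-- Since $|Ly+re_n|\ge|y|$, the integrand is dominated by a multiple of $(1+|y|)^{-\mu}$, uniformly
in $\gamma$, and the Haar measure is finite. This justifies Fubini. -/
theorem integrable_rotated_plane {k : ℕ} {μ : ℝ} (hμ : (k : ℝ) < μ) (hμ0 : 0 < μ)
    {f : EuclideanSpace ℝ (Fin n) → V} (hf : IsCmu μ f)
    (L : EuclideanSpace ℝ (Fin k) →ₗᵢ[ℝ] EuclideanSpace ℝ (Fin n))
    (hn : 0 < n) (hL : ∀ y, inner ℝ (L y) (lastVec n) = 0)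
    (x : EuclideanSpace ℝ (Fin n)) (r : ℝ) :
    Integrable (Function.uncurry fun (γ : SO n) (y : EuclideanSpace ℝ (Fin k)) =>
      f (x + γ.toLinearIsometry (L y + r • lastVec n))) ((haarSO n).prod volume) := by
  obtain ⟨C, hC, hb⟩ := hf.exists_bound hμ0
  have hint := ((integrable_one_add_norm (E := EuclideanSpace ℝ (Fin k))
    (μ := volume) (r := μ) (by simpa using hμ)).const_mul (C * (1 + ‖x‖) ^ μ)).comp_snd (haarSO n)
  have hcont : Continuous (Function.uncurry fun (γ : SO n) (y : EuclideanSpace ℝ (Fin k)) =>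
      f (x + γ.toLinearIsometry (L y + r • lastVec n))) := by
    have hc : Continuous fun p : SO n × EuclideanSpace ℝ (Fin k) =>
        (p.1, L p.2 + r • lastVec n) :=
      continuous_fst.prodMk ((L.continuous.comp continuous_snd).add continuous_const)
    have hc2 := (SO.continuous_action n).comp hc
    simp only [Function.comp_def] at hc2
    have hc3 := hf.1.comp ((continuous_const (y := x)).add hc2)
    simp only [Function.comp_def, Pi.add_apply] at hc3
    simpa only [Function.uncurry_def] using hc3
  refine Integrable.mono' hint hcont.aestronglyMeasurable (ae_of_all _ fun p => ?_)
  refine (norm_add_le_of_bound hμ0 hC hb x _).trans ?_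
  rw [LinearIsometry.norm_map, norm_incl_add hn hL]
  refine mul_le_mul_of_nonneg_left ?_ (by positivity)
  refine Real.rpow_le_rpow_of_nonpos (by positivity) ?_ (by linarith)
  have : ‖p.2‖ ≤ √(‖p.2‖ ^ 2 + r ^ 2) := Real.le_sqrt_of_sq_le (by nlinarith [sq_nonneg r])
  linarith

/-- Polar coordinates followed by $s^2=|y|^2+r^2$. The area $2\pi^{k/2}/\Gamma(k/2)$ of the unit
sphere in $\mathbb R^k$ against the normalization $2/\Gamma(k/2)$ leaves $\pi^{k/2}$. No
integrability of $g$ is needed, as both changes of variables respect the default value 0. -/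
theorem integral_radial_shift [NormedSpace ℝ V] {k : ℕ} (hk : 1 ≤ k) (g : ℝ → V) {r : ℝ}
    (hr : 0 < r) :
    ∫ y : EuclideanSpace ℝ (Fin k), g (√(‖y‖ ^ 2 + r ^ 2)) =
      (Real.pi ^ ((k : ℝ) / 2)) • ekIntegral ((k : ℝ) / 2) g r := by
  have : Nonempty (Fin k) := ⟨⟨0, hk⟩⟩
  have hk0 : (0 : ℝ) < k := by exact_mod_cast hk
  have himg : (fun s : ℝ => √(s ^ 2 - r ^ 2)) '' Ioi r = Ioi 0 := by
    ext u
    constructor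
    · rintro ⟨s, hs, rfl⟩
      have hs : r < s := hs
      exact Real.sqrt_pos.2 (by nlinarith)
    · intro hu
      have hu : 0 < u := hu
      refine ⟨√(u ^ 2 + r ^ 2), Real.lt_sqrt_of_sq_lt (by nlinarith), ?_⟩
      simp only
      rw [Real.sq_sqrt (by positivity), add_sub_cancel_right, Real.sqrt_sq hu.le]
  have hcv := integral_image_eq_integral_deriv_smul_of_monotoneOn (s := Ioi r)
    (f := fun s : ℝ => √(s ^ 2 - r ^ 2)) (f' := fun s => 2 * s / (2 * √(s ^ 2 - r ^ 2)))
    measurableSet_Ioi (fun s hs => by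
      have hs : r < s := hs
      have h1 : HasDerivAt (fun s : ℝ => s ^ 2 - r ^ 2) (2 * s) s := by
        simpa using (hasDerivAt_pow 2 s).sub_const (r ^ 2)
      exact (h1.sqrt (by nlinarith)).hasDerivWithinAt)
    (fun a ha b hb hab => by
      have ha : r < a := ha
      exact Real.sqrt_le_sqrt (by nlinarith))
    (fun u : ℝ => u ^ (k - 1) • g (√(u ^ 2 + r ^ 2)))
  rw [himg] at hcv
  rw [integral_fun_norm_addHaar volume fun u => g (√(u ^ 2 + r ^ 2)), finrank_euclideanSpace_fin,
    hcv, ekIntegral, smul_smul]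
  have he : ∀ s ∈ Ioi r, (2 * s / (2 * √(s ^ 2 - r ^ 2))) •
      (√(s ^ 2 - r ^ 2) ^ (k - 1) • g (√(√(s ^ 2 - r ^ 2) ^ 2 + r ^ 2))) =
      ekIntegrand ((k : ℝ) / 2) g r s := by
    intro s hs
    have hs : r < s := hs
    have hs0 : 0 < s := hr.trans hs
    have h1 : 0 < s ^ 2 - r ^ 2 := by nlinarith
    have hsq := Real.sqrt_pos.2 h1
    rw [Real.sq_sqrt h1.le, sub_add_cancel, Real.sqrt_sq hs0.le, smul_smul, ekIntegrand]
    congr 1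
    have e1 : (s ^ 2 - r ^ 2) ^ ((k : ℝ) / 2 - 1) = √(s ^ 2 - r ^ 2) ^ (k - 1) / √(s ^ 2 - r ^ 2) := by
      rw [eq_div_iff hsq.ne', Real.sqrt_eq_rpow, ← Real.rpow_add h1, ← Real.rpow_mul_natCast h1.le, Nat.cast_sub hk]
      congr 1
      push_cast
      ring
    rw [e1]
    field_simp
  rw [setIntegral_congr_fun measurableSet_Ioi he, ← Nat.cast_smul_eq_nsmul ℝ, smul_smul]
  congr 1
  have hG := (Real.Gamma_pos_of_pos (show (0 : ℝ) < (k : ℝ) / 2 by positivity)).ne'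
  have hpi : √Real.pi ^ k = Real.pi ^ ((k : ℝ) / 2) := by
    rw [Real.sqrt_eq_rpow, ← Real.rpow_natCast, ← Real.rpow_mul Real.pi_pos.le]
    congr 1
    ring
  rw [measureReal_def, EuclideanSpace.volume_ball, Fintype.card_fin, ENNReal.ofReal_one, one_pow,
    one_mul, ENNReal.toReal_ofReal (div_nonneg (by positivity)
      (Real.Gamma_pos_of_pos (by positivity)).le), Real.Gamma_add_one (by positivity), hpi]
  field_simp

end Planes

/-! ### The inversion formula -/

section Inversion

variable {n : ℕ} {V : Type*} [NormedAddCommGroup V] [NormedSpace ℝ V]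

theorem integrable_kPlaneTransform_shiftedPlane {k : ℕ} (hk : 1 ≤ k) (hkn : k < n) {μ : ℝ}
    (hμ : (k : ℝ) < μ) {f : EuclideanSpace ℝ (Fin n) → V} (hf : IsCmu μ f)
    (x : EuclideanSpace ℝ (Fin n)) (r : ℝ) :
    Integrable (fun γ : SO n => kPlaneTransform k f (shiftedPlane k x r γ)) (haarSO n) := by
  obtain ⟨L, hL, hL'⟩ := exists_coord_inclusion hkn
  simp only [kPlaneTransform_shiftedPlane hL]
  exact (integrable_rotated_plane hμ (lt_of_le_of_lt (Nat.cast_nonneg k) hμ) hf L (by omega) hL' x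
    r).integral_prod_left

/-- The shifted dual transform of `Rf` is a fractional integral of the spherical means of `f`. -/
theorem shiftedDual_kPlaneTransform {k : ℕ} (hk : 1 ≤ k) (hkn : k < n) {μ : ℝ}
    (hμ : (k : ℝ) < μ) {f : EuclideanSpace ℝ (Fin n) → V} (hf : IsCmu μ f)
    (x : EuclideanSpace ℝ (Fin n)) {r : ℝ} (hr : 0 < r) :
    shiftedDual k (kPlaneTransform k f) x r =
      (Real.pi ^ ((k : ℝ) / 2)) • ekIntegral ((k : ℝ) / 2) (sphMean f x) r := by
  obtain ⟨L, hL, hL'⟩ := exists_coord_inclusion hkn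
  have hμ0 : 0 < μ := lt_of_le_of_lt (Nat.cast_nonneg k) hμ
  rw [← integral_radial_shift hk _ hr, shiftedDual]
  simp only [kPlaneTransform_shiftedPlane hL]
  -- With the rotations integrated first, each $y$ contributes the spherical mean of radius
  -- $\sqrt{|y|^2+r^2}$.
  rw [integral_integral_swap (integrable_rotated_plane hμ hμ0 hf L (by omega) hL' x r)]
  simp only [integral_rotation (show 2 ≤ n by omega), norm_incl_add (show 0 < n by omega) hL']

/-- Spherical means inherit the decay $s^{-\mu}$. The exponent $c=k-1$ requires $\mu>k$, and
$c=2m+1$ requires $\mu>2m+2$, the extra assumption of the standard form. -/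
theorem integrableOn_rpow_smul_sphMean {μ : ℝ} (hμ : 0 < μ) {f : EuclideanSpace ℝ (Fin n) → V}
    (hf : IsCmu μ f) (hn : 0 < n) (x : EuclideanSpace ℝ (Fin n)) {c : ℝ} (hc : c + 1 < μ) :
    IntegrableOn (fun s : ℝ => s ^ c • sphMean f x s) (Ioi 1) := by
  obtain ⟨C, hC, hb⟩ := hf.exists_bound hμ
  have hint := (integrableOn_Ioi_rpow_of_lt (a := c - μ) (by linarith)
    (zero_lt_one (α := ℝ))).const_mul (C * (1 + ‖x‖) ^ μ)
  refine Integrable.mono' hint ?_ ?_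
  · exact (Measurable.aestronglyMeasurable (by fun_prop)).smul
      (continuous_sphMean hf.1 x).aestronglyMeasurable
  · refine (ae_restrict_mem measurableSet_Ioi).mono fun s hs => ?_
    have hs0 : (0 : ℝ) < s := zero_lt_one.trans hs
    have h1 : ‖sphMean f x s‖ ≤ C * (1 + ‖x‖) ^ μ * s ^ (-μ) := by
      have h2 : ∀ᵐ γ ∂(haarSO n), ‖f (x + s • γ.toLinearIsometry (lastVec n))‖ ≤
          C * (1 + ‖x‖) ^ μ * s ^ (-μ) := by
        refine ae_of_all _ fun γ => (norm_add_le_of_bound hμ hC hb x _).trans ?_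
        rw [norm_smul, LinearIsometry.norm_map, norm_lastVec hn, mul_one,
          Real.norm_of_nonneg hs0.le]
        refine mul_le_mul_of_nonneg_left ?_ (by positivity)
        exact Real.rpow_le_rpow_of_nonpos hs0 (by linarith) (by linarith)
      simpa [sphMean] using norm_integral_le_of_norm_le_const h2
    rw [norm_smul, Real.norm_of_nonneg (Real.rpow_nonneg hs0.le _)]
    calc s ^ c * ‖sphMean f x s‖ ≤ s ^ c * (C * (1 + ‖x‖) ^ μ * s ^ (-μ)) := by gcongr
      _ = C * (1 + ‖x‖) ^ μ * s ^ (c - μ) := by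
        rw [sub_eq_add_neg, Real.rpow_add hs0]
        ring

/-- The spherical means, up to a constant, are the Erdélyi–Kober derivative of `R*_x R f`. -/
theorem isEKDerivative_sphMean {k : ℕ} (hk : 1 ≤ k) (hkn : k < n) {μ : ℝ}
    (hμ : (k : ℝ) < μ) {f : EuclideanSpace ℝ (Fin n) → V} (hf : IsCmu μ f)
    (x : EuclideanSpace ℝ (Fin n)) :
    IsEKDerivative ((k : ℝ) / 2) (shiftedDual k (kPlaneTransform k f) x)
      (fun t => (Real.pi ^ ((k : ℝ) / 2)) • sphMean f x t) where
  continuousOn := ((continuous_sphMean hf.1 x).const_smul _).continuousOn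
  integrableOn := by
    have h := integrableOn_rpow_smul_sphMean (lt_of_le_of_lt (Nat.cast_nonneg k) hμ) hf
      (by omega) x (c := 2 * ((k : ℝ) / 2) - 1) (by linarith)
    refine (h.smul (Real.pi ^ ((k : ℝ) / 2))).congr (ae_of_all _ fun s => ?_)
    exact smul_comm _ _ _
  eq_integral t ht := by
    rw [shiftedDual_kPlaneTransform hk hkn hμ hf x ht, ekIntegral, ekIntegral, smul_comm,
      ← integral_smul]
    congr 2 with s
    exact smul_comm _ _ _

/-- The difference is an average of $f(x)-f(x+t\gamma e_n)$, whose arguments are exactly $|t|$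
apart, so one modulus of continuity serves all $x$. -/
theorem tendstoUniformly_sphMean [CompleteSpace V] {f : EuclideanSpace ℝ (Fin n) → V}
    (hf : UniformContinuous f) (hn : 0 < n) :
    TendstoUniformly (fun (t : ℝ) x => sphMean f x t) f (𝓝 0) := by
  rw [Metric.tendstoUniformly_iff]
  intro ε hε
  obtain ⟨δ, hδ, h⟩ := Metric.uniformContinuous_iff.1 hf (ε / 2) (half_pos hε)
  filter_upwards [Metric.ball_mem_nhds 0 hδ] with t ht x
  rw [mem_ball_zero_iff] at ht
  have hcont : Continuous fun γ : SO n => f (x + t • γ.toLinearIsometry (lastVec n)) := by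
    have h1 : Continuous fun γ : SO n => γ.toLinearIsometry (lastVec n) :=
      (SO.continuous_action n).comp (continuous_id.prodMk continuous_const)
    exact hf.continuous.comp (continuous_const.add (h1.const_smul t))
  have hint : Integrable (fun γ : SO n => f (x + t • γ.toLinearIsometry (lastVec n)))
      (haarSO n) := by
    simpa using hcont.continuousOn.integrableOn_compact (μ := haarSO n) isCompact_univ
  have e : f x - sphMean f x t =
      ∫ γ : SO n, (f x - f (x + t • γ.toLinearIsometry (lastVec n))) ∂(haarSO n) := by
    rw [integral_sub (integrable_const _) hint, sphMean]
    simp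
  rw [dist_eq_norm, e]
  have h2 : ∀ᵐ γ ∂(haarSO n),
      ‖f x - f (x + t • γ.toLinearIsometry (lastVec n))‖ ≤ ε / 2 := by
    refine ae_of_all _ fun γ => ?_
    rw [← dist_eq_norm]
    refine (h ?_).le
    rw [dist_self_add_right, norm_smul, LinearIsometry.norm_map, norm_lastVec hn, mul_one]
    exact ht
  have h3 := norm_integral_le_of_norm_le_const h2
  simp only [probReal_univ, mul_one] at h3
  linarith

end Inversion

end KPlaneInversion

end

/-! ### The inversion theorem -/

theorem theorem3p4 {𝕜 : Type*} [RCLike 𝕜] (n k : ℕ) (hk : 1 ≤ k) (hkn : k < n)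
    (μ : ℝ) (hμ : (k : ℝ) < μ) (f : EuclideanSpace ℝ (Fin n) → 𝕜)
    (hf : KPlaneInversion.IsCmu μ f) :
    -- the transforms `φ = Rf` and `F x = R*_x φ` are given by absolutely convergent integrals
    (∀ τ : AffineSubspace ℝ (EuclideanSpace ℝ (Fin n)), Module.finrank ℝ τ.direction = k →
      IntegrableOn f (τ : Set (EuclideanSpace ℝ (Fin n))) μHE[k]) ∧
    (∀ (x : EuclideanSpace ℝ (Fin n)) (r : ℝ), 0 < r →
      Integrable (fun γ : KPlaneInversion.SO n =>
        KPlaneInversion.kPlaneTransform k f (KPlaneInversion.shiftedPlane k x r γ))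
        (KPlaneInversion.haarSO n)) ∧
    ∀ F : EuclideanSpace ℝ (Fin n) → ℝ → 𝕜,
      F = KPlaneInversion.shiftedDual k (KPlaneInversion.kPlaneTransform k f) →
      -- the Erdélyi–Kober derivative `G x` of order `k / 2` of `R*_x φ` exists, for every `x`
      (∃ G : EuclideanSpace ℝ (Fin n) → ℝ → 𝕜,
        ∀ x, KPlaneInversion.IsEKDerivative ((k : ℝ) / 2) (F x) (G x)) ∧
      ∀ G : EuclideanSpace ℝ (Fin n) → ℝ → 𝕜,
        (∀ x, KPlaneInversion.IsEKDerivative ((k : ℝ) / 2) (F x) (G x)) →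
        -- the inversion formula, uniformly on the whole space
        TendstoUniformly (fun (t : ℝ) x => (Real.pi ^ (-((k : ℝ) / 2))) • G x t) f (𝓝[>] 0) ∧
        -- the form `(-D)^{k/2}` for even `k`
        (Even k → ∀ x,
          KPlaneInversion.CanIterate KPlaneInversion.negD (k / 2) (F x) ∧
          ∀ t : ℝ, 0 < t → G x t = (KPlaneInversion.negD^[k / 2] (F x)) t) ∧
        -- the complemented form, for every `k`
        (∀ x,
          KPlaneInversion.EKConverges (1 - (k : ℝ) / 2 + ((k / 2 : ℕ) : ℝ))
            (KPlaneInversion.powMul (-2 * ((k / 2 : ℕ) : ℝ) - 2) (F x)) ∧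
          KPlaneInversion.CanIterate KPlaneInversion.negD (k / 2 + 1)
            (KPlaneInversion.powMul (k : ℝ) (KPlaneInversion.psi k (F x))) ∧
          ∀ t : ℝ, 0 < t → G x t = KPlaneInversion.complementedForm k (F x) t) ∧
        -- the form with ordinary derivatives, for every `k`
        (∀ x,
          KPlaneInversion.EKConverges ((k : ℝ) / 2)
            (KPlaneInversion.powMul (-(k : ℝ) - 1) (F x)) ∧
          KPlaneInversion.CanIterate KPlaneInversion.negDeriv k
            (KPlaneInversion.powMul 1 (KPlaneInversion.ekIntegral ((k : ℝ) / 2)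
              (KPlaneInversion.powMul (-(k : ℝ) - 1) (F x)))) ∧
          ∀ t : ℝ, 0 < t → G x t = KPlaneInversion.ordinaryForm k (F x) t) ∧
        -- the standard form, under the stronger decay assumption
        (2 + 2 * ((k / 2 : ℕ) : ℝ) < μ → ∀ x,
          KPlaneInversion.EKConverges (1 - (k : ℝ) / 2 + ((k / 2 : ℕ) : ℝ)) (F x) ∧
          KPlaneInversion.CanIterate KPlaneInversion.negD (k / 2 + 1)
            (KPlaneInversion.ekIntegral (1 - (k : ℝ) / 2 + ((k / 2 : ℕ) : ℝ)) (F x)) ∧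
          ∀ t : ℝ, 0 < t → G x t = KPlaneInversion.standardForm k (F x) t) := by
  have hμ0 : 0 < μ := lt_of_le_of_lt (Nat.cast_nonneg k) hμ
  have hn : 0 < n := by omega
  refine ⟨fun τ hτ => ?_, fun x r _ =>
    KPlaneInversion.integrable_kPlaneTransform_shiftedPlane hk hkn hμ hf x r, ?_⟩
  · obtain ⟨p, L, hL⟩ := KPlaneInversion.exists_affine_parametrization hk τ hτ
    rw [IntegrableOn, hL, KPlaneInversion.restrict_range_affine,
      (KPlaneInversion.measurableEmbedding_affine p L).integrable_map_iff]
    exact KPlaneInversion.integrable_affine hμ hμ0 hf p L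
  rintro F rfl
  have hM := KPlaneInversion.isEKDerivative_sphMean hk hkn hμ hf
  refine ⟨⟨_, hM⟩, fun G hG => ?_⟩
  -- By uniqueness, any admissible $G_x$ is $\pi^{k/2}M_xf$ on $(0,\infty)$, which carries the limit
  -- and the extra decay over to it.
  have hGM := fun x => (hG x).eqOn hk (hM x)
  refine ⟨?_, fun hke x => (hG x).even_form hk hke, fun x => (hG x).complemented_form hk,
    fun x => (hG x).ordinary_form hk, fun hμ2 x => (hG x).standard_form hk ?_⟩
  · have h := (KPlaneInversion.tendstoUniformly_sphMean (hf.uniformContinuous hμ0) hn)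
    rw [Metric.tendstoUniformly_iff] at h ⊢
    intro ε hε
    -- The means converge for $t\to0$ from both sides, but $G_x$ is determined only for $t>0$.
    filter_upwards [nhdsWithin_le_nhds (h ε hε), self_mem_nhdsWithin] with t ht ht0 x
    rw [hGM x ht0, smul_smul, ← Real.rpow_add Real.pi_pos, neg_add_cancel, Real.rpow_zero,
      one_smul]
    exact ht x
  · have h := KPlaneInversion.integrableOn_rpow_smul_sphMean hμ0 hf hn x
      (c := 2 * ((k / 2 : ℕ) : ℝ) + 1) (by linarith)
    refine IntegrableOn.congr_fun (h.smul (Real.pi ^ ((k : ℝ) / 2))) (fun s hs => ?_)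
      measurableSet_Ioi
    rw [hGM x (mem_Ioi.2 (zero_lt_one.trans (mem_Ioi.1 hs)))]
    exact smul_comm _ _ _
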